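/- Let $n,k\ge 0$. A constant-action X-program on $n$ qubits consists of an action $\theta\in\mathbb{R}$ and a $k\times n$ matrix $P$ over $\mathbb{F}_2$, whose rows $\mathbf p$ are the program elements. Its output is the random variable $\mathbf X\in\mathbb{F}_2^n$ with distribution $$\mathbb{P}(\mathbf X=\mathbf x)=\Bigl|\langle\mathbf x|\exp\Bigl(i\theta\sum_{\mathbf p}\bigotimes_{j:p_j=1}X_j\Bigr)|\mathbf 0^n\rangle\Bigr|^2,$$ where $X_j$ is the Pauli operator $X=|0\rangle\langle1|+|1\rangle\langle0|$ on qubit $j$ and the sum is over the $k$ rows of $P$. The collision entropy $S_2$ of $\mathbf X$ is defined by $2^{-S_2}=\sum_{\mathbf x}\mathbb{P}(\mathbf X=\mathbf x)^2$. 1. If $\theta$ is an integer multiple of $\pi$, then $\mathbf X=\mathbf 0$ with probability $1$, and $S_2=0$. 2. If $\theta$ is an odd multiple of $\pi/2$, then $\mathbf X=\sum_{\mathbf p}\mathbf p$ (the sum in $\mathbb{F}_2^n$ of the rows of $P$) with probability $1$, and $S_2=0$. 3. If $\theta$ is an odd multiple of $\pi/4$, then the collision entropy need not be zero (for every such $\theta$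 there is a $P$ with $S_2\neq0$), but the distribution can be sampled classically, exactly and in polynomial time: there is a probabilistic Turing machine, using a polynomial number of fair coin flips and polynomial time in the length of its input, which on input a description of $P$ and of $\theta=(2m+1)\pi/4$ (the $n$-bit rows of $P$, the number $n$ in unary, and the integer $m$ in binary) outputs a bit string of length $n$ whose distribution is exactly that of $\mathbf X$. -/

import Mathlib

open scoped Matrix

noncomputable section

/-- Bit strings of length `n`, regarded as vectors over the field with two elements. -/
abbrev BitVec2 (n : ℕ) : Type := Fin n → ZMod 2

/-- The Pauli operator `X = |0⟩⟨1| + |1⟩⟨0|` on one qubit, in the computational basis. -/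
def pauliX : Matrix (ZMod 2) (ZMod 2) ℂ :=
  Matrix.of fun a b => if a = b then 0 else 1

/-- The operator `⨂_{j : p_j = 1} X_j` on `n` qubits, in the computational basis: the tensor
product that has the factor `X` on the qubits `j` with `p_j = 1` and the identity on the others. -/
def pauliXProduct {n : ℕ} (p : BitVec2 n) : Matrix (BitVec2 n) (BitVec2 n) ℂ :=
  Matrix.of fun x y => ∏ j, (if p j = 1 then pauliX else 1) (x j) (y j)

/-- An X-program on `n` qubits: a list of program elements `(θ_p, p)`, an action and a bit string. -/
abbrev XProgram (n : ℕ) : Type := List (ℝ × BitVec2 n)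

/-- The sum `∑_p θ_p ⨂_{j : p_j = 1} X_j` over the program elements. -/
def XProgram.hamiltonian {n : ℕ} (Q : XProgram n) : Matrix (BitVec2 n) (BitVec2 n) ℂ :=
  (Q.map fun e => (e.1 : ℂ) • pauliXProduct e.2).sum

/-- The output distribution of an X-program,
`ℙ(X = x) = |⟨x| exp(∑_p i θ_p ⨂_{j : p_j = 1} X_j) |0ⁿ⟩|²`. -/
def XProgram.outputProb {n : ℕ} (Q : XProgram n) (x : BitVec2 n) : ℝ :=
  ‖NormedSpace.exp (Complex.I • Q.hamiltonian) x 0‖ ^ 2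

/-- The X-program with constant action `θ` whose program elements are the rows of the binary
matrix `P`. -/
def XProgram.constantAction {k n : ℕ} (θ : ℝ) (P : Matrix (Fin k) (Fin n) (ZMod 2)) :
    XProgram n :=
  List.ofFn fun i => (θ, P i)

/-- The collision entropy `S₂` of a probability mass function `D` on a finite type, in bits:
`2 ^ (-S₂) = ∑ x, D x ^ 2`. -/
def collisionEntropy {β : Type} [Fintype β] (D : β → ℝ) : ℝ :=
  -Real.logb 2 (∑ x, D x ^ 2)

/-- The alphabet in which the inputs of algorithms are written. -/
inductive InputSymbol : Type
  | bit (b : Bool)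
  | comma
  | semicolon

/-- The bits of a vector over the field with two elements, as a list of length `n`. -/
def bitList {n : ℕ} (x : BitVec2 n) : List Bool :=
  List.ofFn fun j => decide (x j = 1)

/-- Exact classical simulation (sampling) in polynomial time. Given are a type `α` of inputs, with
an encoding, and for every input `a` a distribution `D a` on bit strings of length `width a`.
There has to be one deterministic Turing machine with polynomial running time that maps an input
`a` and `q(|a|)` coin flips `r`, with `q` a polynomial and `|a|` the length of the encoding of `a`,
to a bit string, such that for uniformly random `r` the distribution of the bit string
is exactly `D a`. (The running time is polynomial in the length of the word
`a ; r`, hence in `|a|`.) -/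
def ExactlySamplableInPolyTime {α : Type} (encode : α → List InputSymbol) (width : α → ℕ)
    (D : (a : α) → BitVec2 (width a) → ℝ) : Prop :=
  ∃ (q : Polynomial ℕ)
    (sample : (a : α) → (Fin (q.eval (encode a).length) → Bool) → BitVec2 (width a)),
    Nonempty (Turing.TM2ComputableInPolyTime
      (α := Σ a : α, (Fin (q.eval (encode a).length) → Bool)) (β := List Bool)
      (fun w => encode w.1 ++ InputSymbol.semicolon :: List.ofFn fun i => InputSymbol.bit (w.2 i))
      (fun l => l)
      (fun w => bitList (sample w.1 w.2))) ∧
    ∀ (a : α) (x : BitVec2 (width a)),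
      D a x = (Nat.card {r : Fin (q.eval (encode a).length) → Bool // sample a r = x} : ℝ)
        / 2 ^ (q.eval (encode a).length)

/-- A description of a constant-action X-program whose action is an odd multiple of `π / 4`:
the binary matrix `P` and the integer `m` for which the action is `(2 * m + 1) * (π / 4)`. -/
structure QuarterProgram : Type where
  /-- the number of program elements -/
  k : ℕ
  /-- the number of qubits -/
  n : ℕ
  /-- the matrix whose rows are the program elements -/
  P : Matrix (Fin k) (Fin n) (ZMod 2)
  /-- the action is `(2 * m + 1) * (π / 4)` -/
  m : ℤ

/-- The action of the program. -/
def QuarterProgram.action (Q : QuarterProgram) : ℝ := (2 * (Q.m : ℝ) + 1) * (Real.pi / 4)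

/-- The X-program that is described. -/
def QuarterProgram.toXProgram (Q : QuarterProgram) : XProgram Q.n :=
  XProgram.constantAction Q.action Q.P

/-- The description as a word: the sign and the binary digits of `m`, a semicolon, `n` in unary,
a semicolon, and then the rows of `P`, each of them followed by a comma. -/
def QuarterProgram.encode (Q : QuarterProgram) : List InputSymbol :=
  (decide (Q.m < 0) :: Computability.encodeNat Q.m.natAbs).map InputSymbol.bit
    ++ InputSymbol.semicolon :: List.replicate Q.n (InputSymbol.bit true)
    ++ InputSymbol.semicolon ::
      (List.ofFn fun i => (bitList (Q.P i)).map InputSymbol.bit ++ [InputSymbol.comma]).flatten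

end

/-! The characters `sign (x ⬝ᵥ c)` are eigenvectors of all the operators `pauliXProduct p` at once.
So, up to a global phase, the amplitude at x is the average over c of sign(x·c) z^|Pc|, where z =
exp(-2iθ) and |·| is the Hamming weight (`outputProb_constantAction`). For θ in πℤ, z = 1; for odd
multiples of π/2, z = -1. In both cases z^|Pc| is a character of c, and its Fourier transform is a
point mass.

For odd multiples of π/4, z² = -1 and only |Pc| modulo 4 matters. Since |v+w| = |v| + |w| + 2 v·w
modulo 4, summing over c in the squared amplitude leaves only the e in the kernel of PᵀP
(`normSq_sum_sign`). On that kernel |Pe| is additive and even, so |Pe| = 2 (e·s) modulo 4 for some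
vector s (`weight_mulVec`). Hence X is uniform on the coset s + im(PᵀP), and s + PᵀPr with uniform
bits r has exactly this law (`card_fiber`). The law is the same for every odd multiple of π/4.

To find s, P is reduced by column operations to W = PV with PᵀW = 0 and V the identity on the kernel
of PᵀP. The columns of W are then orthogonal to themselves and to each other, so their weights are
even, and s_j is half the weight of column j, modulo 2. The operations are sweeps over the rows,
which a stack machine with finitely many registers carries out in cubic time (`runs_machine`,
`runTime_le`). -/

noncomputable section

namespace QuarterSampler

open Turing

/-! ### The Turing machine: data and program. -/

/-- An entry of the binary matrix together with the entry of the reduced matrix. -/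
structure Cell : Type where
  entry : ZMod 2
  reduced : ZMod 2

instance : Fintype Cell :=
  Fintype.ofInjective (fun a => (a.entry, a.reduced)) <| by rintro ⟨⟩ ⟨⟩ h; simpa using h

/-- The data that the machine keeps for a column: a coin flip, the mark of the column whose test
is run, the test vector that is being gathered, the pivot vector and the test vector of the current
reduction, and a counter modulo four. -/
structure Column : Type where
  coin : ZMod 2
  mark : ZMod 2
  gathered : ZMod 2
  pivot : ZMod 2
  test : ZMod 2
  count : ZMod 4

instance : Fintype Column :=
  Fintype.ofInjective (fun c => (c.coin, c.mark, c.gathered, c.pivot, c.test, c.count)) <| by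
    rintro ⟨⟩ ⟨⟩ h; simpa using h

/-- The column all of whose fields vanish. -/
def Column.blank : Column := ⟨0, 0, 0, 0, 0, 0⟩

/-- The lift of a bit to an integer modulo four. -/
def lift (x : ZMod 2) : ZMod 4 := if x = 1 then 1 else 0

/-- The three kinds of sweeps through the rows. -/
inductive Mode : Type
  | gather
  | update
  | final
  deriving DecidableEq

instance : Fintype Mode := ⟨{.gather, .update, .final}, by rintro ⟨⟩ <;> simp⟩

/-- The contribution of an entry to the bit that a sweep computes for a row. -/
def Mode.probe : Mode → Cell → Column → ZMod 2
  | gather, a, c => a.entry * c.mark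
  | update, a, c => a.reduced * c.pivot
  | final, a, c => a.entry * c.coin

/-- The new entry of the row, given the bit of the row. -/
def Mode.newCell : Mode → ZMod 2 → Cell → Column → Cell
  | update, b, a, c => ⟨a.entry, a.reduced + b * c.test⟩
  | _, _, a, _ => a

/-- The new column, given the bit of the row. -/
def Mode.newColumn : Mode → ZMod 2 → Cell → Column → Column
  | gather, b, a, c => { c with gathered := c.gathered + b * a.reduced }
  | update, _, _, c => c
  | final, b, a, c => { c with count := c.count + (lift a.reduced + 2 * lift (b * a.entry)) }

/-- The stack from which a sweep takes the rows; it puts them on the other one. -/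
def Mode.source : Mode → Bool
  | update => true
  | _ => false

/-- The stacks of the machine. -/
inductive Stack : Type
  | input
  | output
  | rows (b : Bool)
  | row
  | left
  | right
  deriving DecidableEq, Fintype

/-- The alphabets of the stacks. -/
abbrev Alphabet : Stack → Type
  | .input => InputSymbol
  | .output => Bool
  | .rows _ => Option Cell
  | .row => Cell
  | .left => Column
  | .right => Column

/-- The labels of the machine. -/
inductive Label : Type
  | skip
  | readWidth
  | loadForth
  | loadBack
  | flip
  | drain
  | pivotForth
  | pivotBack
  | forth (m : Mode)
  | back (m : Mode)
  | collect
  | write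
  | clear
  deriving DecidableEq, Fintype

instance : Fintype InputSymbol :=
  Fintype.ofEquiv (Option (Option Bool))
    { toFun
        | none => .comma
        | some none => .semicolon
        | some (some b) => .bit b
      invFun
        | .comma => none
        | .semicolon => some none
        | .bit b => some (some b)
      left_inv := by rintro (_ | _ | _) <;> rfl
      right_inv := by rintro (_ | _ | _) <;> rfl }

/-- The registers of the machine. -/
structure Registers : Type where
  symbol : Option InputSymbol
  cell : Option (Option Cell)
  column : Option Column
  acc : ZMod 2
  carry : ZMod 2

instance : Fintype Registers :=
  Fintype.ofInjective (fun s => (s.symbol, s.cell, s.column, s.acc, s.carry)) <| by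
    rintro ⟨⟩ ⟨⟩ h; simpa using h

/-- The registers at the beginning of a step. -/
def Registers.clean (acc carry : ZMod 2) : Registers := ⟨none, none, none, acc, carry⟩

/-- The label at which the machine continues after a sweep. -/
def Mode.next : Mode → ZMod 2 → Label
  | gather, _ => .pivotForth
  | update, carry => if carry = 1 then .forth .final else .forth .gather
  | final, _ => .collect

open TM2.Stmt

/-- The bit of an input symbol. -/
def symbolBit : InputSymbol → ZMod 2
  | .bit true => 1
  | _ => 0

/-- The column after a pivot pass: the accumulator tells whether the gathered test vector had an
entry in an earlier column, and the carry is the mark of the previous column. -/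
def pivotColumn (acc carry : ZMod 2) (c : Column) : Column :=
  ⟨c.coin, carry, 0, if acc = 0 then c.gathered else 0, c.gathered, c.count⟩

/-- The statement that clears the registers except the accumulator and the carry,
and goes to a label. -/
def cleanGoto (l : Label) : TM2.Stmt Alphabet Label Registers :=
  load (fun s => .clean s.acc s.carry) <| goto fun _ => l

/-- The program of the machine. -/
def program : Label → TM2.Stmt Alphabet Label Registers
  | .skip =>
    pop .input (fun s (a : Option InputSymbol) => { s with symbol := a }) <|
    branch (fun s => s.symbol matches some .semicolon) (cleanGoto .readWidth) (cleanGoto .skip)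
  | .readWidth =>
    pop .input (fun s (a : Option InputSymbol) => { s with symbol := a }) <|
    branch (fun s => s.symbol matches some .semicolon) (cleanGoto .loadForth) <|
    push .right (fun _ => Column.blank) <| cleanGoto .readWidth
  | .loadForth =>
    pop .input (fun s (a : Option InputSymbol) => { s with symbol := a }) <|
    branch (fun s => s.symbol matches some .semicolon) (cleanGoto .flip) <|
    branch (fun s => s.symbol matches some .comma)
      (push (.rows true) (fun _ => (none : Option Cell)) <| cleanGoto .loadBack) <|
    -- Both fields receive the same bit, because the reduction starts from P itself.
    push .row (fun s => (⟨(s.symbol.map symbolBit).getD 0, (s.symbol.map symbolBit).getD 0⟩ : Cell))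
      <| cleanGoto .loadForth
  | .loadBack =>
    -- With the extra `some`, the value `some none` means that `row` is empty. On the stacks `rows
    -- b` the same value is the end mark of a row, and `none` means an empty stack.
    pop .row (fun s (a : Option Cell) => { s with cell := some a }) <|
    branch (fun s => s.cell matches some none) (cleanGoto .loadForth) <|
    push (.rows true) (fun s => s.cell.getD none) <| cleanGoto .loadBack
  | .flip =>
    pop .right (fun s (a : Option Column) => { s with column := a }) <|
    branch (fun s => s.column.isNone) (cleanGoto .drain) <|
    pop .input (fun s (a : Option InputSymbol) => { s with symbol := a }) <|
    push .left (fun s => ({ Column.blank with coin := (s.symbol.map symbolBit).getD 0 } : Column))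
      <| cleanGoto .flip
  | .drain =>
    pop .input (fun s (a : Option InputSymbol) => { s with symbol := a }) <|
    branch (fun s => s.symbol.isNone)
      -- The carry 1 enters the first pivot pass as the mark of column 0.
      (load (fun _ => .clean 0 1) <| goto fun _ => .pivotForth) (cleanGoto .drain)
  | .pivotForth =>
    pop .left (fun s (a : Option Column) => { s with column := a }) <|
    branch (fun s => s.column.isNone)
      (load (fun s => .clean 0 s.carry) <| goto fun _ => .pivotBack) <|
    push .right (fun s => pivotColumn s.acc s.carry (s.column.getD .blank)) <|
    load (fun s => .clean (if s.acc = 0 then (s.column.getD .blank).gathered else s.acc)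
      (s.column.getD .blank).mark) <| goto fun _ => .pivotForth
  | .pivotBack =>
    pop .right (fun s (a : Option Column) => { s with column := a }) <|
    branch (fun s => s.column.isNone) (cleanGoto (.forth .update)) <|
    push .left (fun s => s.column.getD .blank) <| cleanGoto .pivotBack
  | .forth m =>
    pop (.rows m.source) (fun s (a : Option (Option Cell)) => { s with cell := a }) <|
    branch (fun s => s.cell.isNone)
      (load (fun s => .clean 0 s.carry) <| goto fun s => m.next s.carry) <|
    branch (fun s => s.cell matches some none)
      (push (.rows !m.source) (fun _ => (none : Option Cell)) <| cleanGoto (.back m)) <|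
    pop .left (fun s (a : Option Column) => { s with column := a }) <|
    push .row (fun s => (s.cell.getD none).getD ⟨0, 0⟩) <|
    -- The default column is not used on well-formed stacks, where a row has as many cells as there
    -- are columns.
    push .right (fun s => s.column.getD .blank) <|
    load (fun s => .clean (s.acc + m.probe ((s.cell.getD none).getD ⟨0, 0⟩) (s.column.getD .blank))
      s.carry) <| goto fun _ => .forth m
  | .back m =>
    pop .row (fun s (a : Option Cell) => { s with cell := some a }) <|
    branch (fun s => s.cell matches some none)
      (load (fun s => .clean 0 s.carry) <| goto fun _ => .forth m) <|
    pop .right (fun s (a : Option Column) => { s with column := a }) <|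
    push (.rows !m.source) (fun s => some (m.newCell s.acc ((s.cell.getD none).getD ⟨0, 0⟩)
      (s.column.getD .blank))) <|
    push .left (fun s => m.newColumn s.acc ((s.cell.getD none).getD ⟨0, 0⟩)
      (s.column.getD .blank)) <|
    cleanGoto (.back m)
  | .collect =>
    pop .left (fun s (a : Option Column) => { s with column := a }) <|
    branch (fun s => s.column.isNone) (cleanGoto .write) <|
    push .right (fun s => s.column.getD .blank) <| cleanGoto .collect
  | .write =>
    pop .right (fun s (a : Option Column) => { s with column := a }) <|
    branch (fun s => s.column.isNone) (cleanGoto .clear) <|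
    push .output (fun s => decide (2 ≤ (s.column.getD .blank).count.val)) <| cleanGoto .write
  | .clear =>
    pop (.rows true) (fun s (a : Option (Option Cell)) => { s with cell := a }) <|
    branch (fun s => s.cell.isNone) (load (fun _ => .clean 0 0) halt) (cleanGoto .clear)

/-- The machine. -/
def machine : FinTM2 where
  K := Stack
  k₀ := .input
  k₁ := .output
  Γ := Alphabet
  Λ := Label
  main := .skip
  σ := Registers
  initialState := .clean 0 0
  Γk₀Fin := inferInstanceAs (Fintype InputSymbol)
  m := program

/-! ### Stack contents and configurations. -/

/-- The contents of the stacks, seen from a sweep in a given direction. -/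
structure Memory : Type where
  input : List InputSymbol
  output : List Bool
  source : List (Option Cell)
  target : List (Option Cell)
  row : List Cell
  left : List Column
  right : List Column

/-- The stacks with the given contents, where the source is the stack `rows b`. -/
def Memory.stacks (M : Memory) (b : Bool) : ∀ k, List (Alphabet k)
  | .input => M.input
  | .output => M.output
  | .rows b' => if b' = b then M.source else M.target
  | .row => M.row
  | .left => M.left
  | .right => M.right

section StackLemmas
variable (M : Memory) (b : Bool)

@[simp] theorem stacks_input : M.stacks b .input = M.input := rfl
@[simp] theorem stacks_output : M.stacks b .output = M.output := rfl
@[simp] theorem stacks_source : M.stacks b (.rows b) = M.source := by simp [Memory.stacks]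
@[simp] theorem stacks_target : M.stacks b (.rows !b) = M.target := by simp [Memory.stacks]
@[simp] theorem stacks_row : M.stacks b .row = M.row := rfl
@[simp] theorem stacks_left : M.stacks b .left = M.left := rfl
@[simp] theorem stacks_right : M.stacks b .right = M.right := rfl

@[simp] theorem update_input (l : List InputSymbol) :
    Function.update (M.stacks b) .input l = { M with input := l }.stacks b := by
  funext k; cases k <;> simp [Memory.stacks, Function.update]

@[simp] theorem update_output (l : List Bool) :
    Function.update (M.stacks b) .output l = { M with output := l }.stacks b := by
  funext k; cases k <;> simp [Memory.stacks, Function.update]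

@[simp] theorem update_source (l : List (Option Cell)) :
    Function.update (M.stacks b) (.rows b) l = { M with source := l }.stacks b := by
  funext k; rcases k with _ | _ | b' | _ | _ | _ <;> try simp [Memory.stacks, Function.update]
  by_cases h : b' = b
  · subst h; simp
  · simp [h]

@[simp] theorem update_target (l : List (Option Cell)) :
    Function.update (M.stacks b) (.rows !b) l = { M with target := l }.stacks b := by
  funext k; rcases k with _ | _ | b' | _ | _ | _ <;> try simp [Memory.stacks, Function.update]
  by_cases h : b' = !b
  · subst h; simp
  · have : b' = b := by revert h; cases b <;> cases b' <;> simp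
    simp [this]

@[simp] theorem update_row (l : List Cell) :
    Function.update (M.stacks b) .row l = { M with row := l }.stacks b := by
  funext k; cases k <;> simp [Memory.stacks, Function.update]

@[simp] theorem update_left (l : List Column) :
    Function.update (M.stacks b) .left l = { M with left := l }.stacks b := by
  funext k; cases k <;> simp [Memory.stacks, Function.update]

@[simp] theorem update_right (l : List Column) :
    Function.update (M.stacks b) .right l = { M with right := l }.stacks b := by
  funext k; cases k <;> simp [Memory.stacks, Function.update]

@[simp] theorem stacks_false_true : M.stacks false (.rows true) = M.target :=
  stacks_target M false

@[simp] theorem update_false_true (l : List (Option Cell)) :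
    Function.update (M.stacks false) (.rows true) l = { M with target := l }.stacks false :=
  update_target M false l

/-- Update sweeps move the rows in the opposite direction to the other sweeps; this translates
between the two points of view. -/
theorem stacks_not : M.stacks (!b) = { M with source := M.target, target := M.source }.stacks b := by
  funext k; rcases k with _ | _ | b' | _ | _ | _ <;> try simp [Memory.stacks]
  cases b <;> cases b' <;> simp

end StackLemmas

/-- The configuration at a label. -/
def config (l : Label) (acc carry : ZMod 2) (b : Bool) (M : Memory) :
    TM2.Cfg Alphabet Label Registers :=
  ⟨some l, .clean acc carry, M.stacks b⟩

/-- The machine gets from one configuration to another one in `t` steps. -/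
def Runs (t : ℕ) (c d : TM2.Cfg Alphabet Label Registers) : Prop :=
  (flip bind (TM2.step program))^[t] (some c) = some d

theorem Runs.trans {s t : ℕ} {c d e : TM2.Cfg Alphabet Label Registers} (h : Runs s c d)
    (h' : Runs t d e) : Runs (s + t) c e := by
  unfold Runs at *
  rw [add_comm, Function.iterate_add_apply, h, h']

theorem Runs.of_step {c d : TM2.Cfg Alphabet Label Registers}
    (h : TM2.step program c = some d) : Runs 1 c d := h

theorem Runs.cons {t : ℕ} {c d e : TM2.Cfg Alphabet Label Registers}
    (h : TM2.step program c = some d) (h' : Runs t d e) : Runs (t + 1) c e := by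
  rw [add_comm]; exact (Runs.of_step h).trans h'

/-! ### Runs of the single phases. -/

theorem runs_skip (l : List Bool) (rest : List InputSymbol) (M : Memory) :
    Runs (l.length + 1)
      (config .skip 0 0 false { M with input := l.map .bit ++ .semicolon :: rest })
      (config .readWidth 0 0 false { M with input := rest }) := by
  induction l with
  | nil => exact Runs.of_step (by simp [config, program, cleanGoto, Registers.clean])
  | cons a l ih => exact Runs.cons (by simp [config, program, cleanGoto, Registers.clean]) ih

theorem runs_readWidth (n : ℕ) (rest : List InputSymbol) (M : Memory) (l : List Column) :
    Runs (n + 1)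
      (config .readWidth 0 0 false
        { M with input := List.replicate n (.bit true) ++ .semicolon :: rest, right := l })
      (config .loadForth 0 0 false
        { M with input := rest, right := List.replicate n .blank ++ l }) := by
  induction n generalizing l with
  | zero => exact Runs.of_step (by simp [config, program, cleanGoto, Registers.clean])
  | succ n ih =>
    have e : List.replicate (n + 1) Column.blank ++ l
        = List.replicate n Column.blank ++ .blank :: l := by
      rw [List.replicate_succ', List.append_assoc, List.singleton_append]
    rw [e]
    exact Runs.cons (by simp [config, program, cleanGoto, Registers.clean, List.replicate_succ])
      (ih _)

/-- The entry that is read from a bit. -/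
def bitCell (b : Bool) : Cell := ⟨symbolBit (.bit b), symbolBit (.bit b)⟩

theorem runs_loadForth_row (l : List Bool) (rest : List InputSymbol) (M : Memory)
    (row : List Cell) :
    Runs (l.length + 1)
      (config .loadForth 0 0 false
        { M with input := l.map .bit ++ .comma :: rest, row := row })
      (config .loadBack 0 0 false
        { M with
          input := rest, target := none :: M.target, row := (l.map bitCell).reverse ++ row }) := by
  induction l generalizing row with
  | nil => exact Runs.of_step (by simp [config, program, cleanGoto, Registers.clean])
  | cons a l ih =>
    simp only [List.map_cons, List.reverse_cons, List.append_assoc, List.singleton_append]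
    exact Runs.cons (by simp [config, program, cleanGoto, Registers.clean, bitCell]) (ih _)

theorem runs_loadBack (l : List Cell) (M : Memory) (target : List (Option Cell)) :
    Runs (l.length + 1)
      (config .loadBack 0 0 false { M with row := l, target := target })
      (config .loadForth 0 0 false
        { M with row := [], target := (l.map some).reverse ++ target }) := by
  induction l generalizing target with
  | nil => exact Runs.of_step (by simp [config, program, cleanGoto, Registers.clean])
  | cons a l ih =>
    simp only [List.map_cons, List.reverse_cons, List.append_assoc, List.singleton_append]
    exact Runs.cons (by simp [config, program, cleanGoto, Registers.clean]) (ih _)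

/-- The word that represents a list of rows on a stack. -/
def rowsWord {n : ℕ} (rows : List (Fin n → Cell)) : List (Option Cell) :=
  rows.flatMap fun r => (List.ofFn r).map some ++ [none]

@[simp] theorem rowsWord_nil {n : ℕ} : rowsWord ([] : List (Fin n → Cell)) = [] := rfl

theorem rowsWord_cons {n : ℕ} (r : Fin n → Cell) (rows : List (Fin n → Cell)) :
    rowsWord (r :: rows) = (List.ofFn r).map some ++ none :: rowsWord rows := by
  simp [rowsWord]

/-- Passing through `row` reverses a row twice, so its entries keep their order, whereas the rows
themselves pile up with the first one at the bottom. -/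
theorem runs_load {n : ℕ} (rows : List (Fin n → Bool)) (rest : List InputSymbol) (M : Memory)
    (done : List (Fin n → Cell)) :
    Runs (rows.length * (2 * n + 2) + 1)
      (config .loadForth 0 0 false
        { M with
          input := (rows.flatMap fun r => (List.ofFn r).map .bit ++ [.comma])
            ++ .semicolon :: rest
          target := rowsWord done
          row := [] })
      (config .flip 0 0 false
        { M with
          input := rest
          target := rowsWord ((rows.map fun r j => bitCell (r j)).reverse ++ done)
          row := [] }) := by
  induction rows generalizing done with
  | nil =>
    simp only [List.length_nil, Nat.zero_mul]
    exact Runs.of_step (by simp [config, program, cleanGoto, Registers.clean])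
  | cons r rows ih =>
    have h₁ := runs_loadForth_row (List.ofFn r)
      ((rows.flatMap fun r => (List.ofFn r).map .bit ++ [.comma]) ++ .semicolon :: rest)
      { M with target := rowsWord done } []
    have h₂ := runs_loadBack ((List.ofFn r).map bitCell).reverse
      { M with input :=
        (rows.flatMap fun r => (List.ofFn r).map .bit ++ [.comma]) ++ .semicolon :: rest }
      (none :: rowsWord done)
    have h₃ := ih ((fun j => bitCell (r j)) :: done)
    simp only [List.append_nil] at h₁
    simp only [List.map_reverse, List.reverse_reverse, List.map_ofFn] at h₂
    rw [rowsWord_cons, List.map_ofFn] at h₃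
    simp only [List.flatMap_cons, List.append_assoc, List.singleton_append, List.map_cons,
      List.reverse_cons]
    simp only [List.map_ofFn] at *
    have h := (h₁.trans h₂).trans h₃
    simp only [List.length_reverse, List.length_ofFn] at h
    rw [List.length_cons, show (rows.length + 1) * (2 * n + 2) + 1
      = n + 1 + (n + 1) + (rows.length * (2 * n + 2) + 1) by ring]
    exact h

/-- Moving the columns from `right` to `left` assigns the first coin to the last column; this is the
origin of `j.rev` in `coinVec`. -/
theorem runs_flip (l : List Bool) (rest : List InputSymbol) (M : Memory) (left : List Column) :
    Runs (l.length + 1)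
      (config .flip 0 0 false
        { M with
          input := l.map .bit ++ rest, right := List.replicate l.length .blank, left := left })
      (config .drain 0 0 false
        { M with
          input := rest
          right := []
          left := (l.map fun b => { Column.blank with coin := symbolBit (.bit b) }).reverse
            ++ left }) := by
  induction l generalizing left with
  | nil => exact Runs.of_step (by simp [config, program, cleanGoto, Registers.clean])
  | cons a l ih =>
    simp only [List.map_cons, List.reverse_cons, List.append_assoc, List.singleton_append]
    exact Runs.cons (by simp [config, program, cleanGoto, Registers.clean, List.replicate_succ])
      (ih _)

theorem runs_drain (l : List InputSymbol) (M : Memory) :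
    Runs (l.length + 1) (config .drain 0 0 false { M with input := l })
      (config .pivotForth 0 1 false { M with input := [] }) := by
  induction l with
  | nil => exact Runs.of_step (by simp [config, program, Registers.clean])
  | cons a l ih => exact Runs.cons (by simp [config, program, cleanGoto, Registers.clean]) ih

/-- The effect of a pivot pass on the accumulator, the carry and the columns. -/
def pivotPass : ZMod 2 → ZMod 2 → List Column → ZMod 2 × List Column
  | _, carry, [] => (carry, [])
  | acc, carry, c :: l =>
    let r := pivotPass (if acc = 0 then c.gathered else acc) c.mark l
    (r.1, pivotColumn acc carry c :: r.2)

theorem runs_pivotForth (l : List Column) (M : Memory) (acc carry : ZMod 2)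
    (right : List Column) :
    Runs (l.length + 1)
      (config .pivotForth acc carry false { M with left := l, right := right })
      (config .pivotBack 0 (pivotPass acc carry l).1 false
        { M with left := [], right := (pivotPass acc carry l).2.reverse ++ right }) := by
  induction l generalizing acc carry right with
  | nil => exact Runs.of_step (by simp [config, program, Registers.clean, pivotPass])
  | cons a l ih =>
    simp only [pivotPass, List.reverse_cons, List.append_assoc, List.singleton_append]
    exact Runs.cons (by simp [config, program, Registers.clean]) (ih _ _ _)

theorem runs_pivotBack (l : List Column) (M : Memory) (carry : ZMod 2) (left : List Column) :
    Runs (l.length + 1)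
      (config .pivotBack 0 carry false { M with left := left, right := l })
      (config (.forth .update) 0 carry false { M with left := l.reverse ++ left, right := [] }) := by
  induction l generalizing left with
  | nil => exact Runs.of_step (by simp [config, program, cleanGoto, Registers.clean])
  | cons a l ih =>
    simp only [List.reverse_cons, List.append_assoc, List.singleton_append]
    exact Runs.cons (by simp [config, program, cleanGoto, Registers.clean]) (ih _)

theorem runs_forth (m : Mode) (l : List (Cell × Column)) (M : Memory) (acc carry : ZMod 2)
    (source : List (Option Cell)) (row : List Cell) (right : List Column) :
    Runs (l.length + 1)
      (config (.forth m) acc carry m.source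
        { M with
          source := l.map (fun z => some z.1) ++ none :: source
          row := row
          left := l.map Prod.snd
          right := right })
      (config (.back m) (acc + (l.map fun z => m.probe z.1 z.2).sum) carry m.source
        { M with
          source := source
          target := none :: M.target
          row := (l.map Prod.fst).reverse ++ row
          left := []
          right := (l.map Prod.snd).reverse ++ right }) := by
  induction l generalizing acc row right with
  | nil => exact Runs.of_step (by simp [config, program, cleanGoto, Registers.clean])
  | cons a l ih =>
    simp only [List.map_cons, List.reverse_cons, List.append_assoc, List.singleton_append,
      List.sum_cons, ← add_assoc acc]
    exact Runs.cons (by simp [config, program, Registers.clean]) (ih _ _ _)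

theorem runs_back (m : Mode) (l : List (Cell × Column)) (M : Memory) (acc carry : ZMod 2)
    (target : List (Option Cell)) (left : List Column) :
    Runs (l.length + 1)
      (config (.back m) acc carry m.source
        { M with
          target := target
          row := l.map Prod.fst
          left := left
          right := l.map Prod.snd })
      (config (.forth m) 0 carry m.source
        { M with
          target := (l.map fun z => some (m.newCell acc z.1 z.2)).reverse ++ target
          row := []
          left := (l.map fun z => m.newColumn acc z.1 z.2).reverse ++ left
          right := [] }) := by
  induction l generalizing target left with
  | nil => exact Runs.of_step (by simp [config, program, Registers.clean])
  | cons a l ih =>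
    simp only [List.map_cons, List.reverse_cons, List.append_assoc, List.singleton_append]
    exact Runs.cons (by simp [config, program, cleanGoto, Registers.clean]) (ih _ _)

theorem runs_collect (l : List Column) (M : Memory) (carry : ZMod 2) (right : List Column) :
    Runs (l.length + 1)
      (config .collect 0 carry false { M with left := l, right := right })
      (config .write 0 carry false { M with left := [], right := l.reverse ++ right }) := by
  induction l generalizing right with
  | nil => exact Runs.of_step (by simp [config, program, cleanGoto, Registers.clean])
  | cons a l ih =>
    simp only [List.reverse_cons, List.append_assoc, List.singleton_append]
    exact Runs.cons (by simp [config, program, cleanGoto, Registers.clean]) (ih _)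

/-- The bit that is written for a column. -/
def Column.result (c : Column) : Bool := decide (2 ≤ c.count.val)

theorem runs_write (l : List Column) (M : Memory) (carry : ZMod 2) (output : List Bool) :
    Runs (l.length + 1)
      (config .write 0 carry false { M with right := l, output := output })
      (config .clear 0 carry false
        { M with right := [], output := (l.map Column.result).reverse ++ output }) := by
  induction l generalizing output with
  | nil => exact Runs.of_step (by simp [config, program, cleanGoto, Registers.clean])
  | cons a l ih =>
    simp only [List.map_cons, List.reverse_cons, List.append_assoc, List.singleton_append]
    exact Runs.cons (by simp [config, program, cleanGoto, Registers.clean, Column.result]) (ih _)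

theorem runs_clear (l : List (Option Cell)) (M : Memory) (carry : ZMod 2) :
    Runs (l.length + 1)
      (config .clear 0 carry false { M with target := l })
      ⟨none, .clean 0 0, { M with target := [] }.stacks false⟩ := by
  induction l with
  | nil => exact Runs.of_step (by simp [config, program, Registers.clean])
  | cons a l ih => exact Runs.cons (by simp [config, program, cleanGoto, Registers.clean]) ih

/-! ### Sweeps through the rows. -/

section Sweep

variable {n : ℕ} (m : Mode)

/-- The bit that a sweep computes for a row. -/
def Mode.rowBit (r : Fin n → Cell) (c : Fin n → Column) : ZMod 2 := ∑ j, m.probe (r j) (c j)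

/-- The columns after a sweep. -/
def Mode.sweepColumns : (Fin n → Column) → List (Fin n → Cell) → Fin n → Column
  | c, [] => c
  | c, r :: rows => sweepColumns (fun j => m.newColumn (m.rowBit r c) (r j) (c j)) rows

/-- The rows after a sweep. -/
def Mode.sweepRows : (Fin n → Column) → List (Fin n → Cell) → List (Fin n → Cell)
  | _, [] => []
  | c, r :: rows => (fun j => m.newCell (m.rowBit r c) (r j) (c j)) ::
      sweepRows (fun j => m.newColumn (m.rowBit r c) (r j) (c j)) rows

/-- The bit of a row is known only after its last entry, so the row is traversed twice: `forth`
accumulates the bit, and `back` applies it while restoring the order of cells and columns. -/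
theorem runs_row (r : Fin n → Cell) (c : Fin n → Column) (M : Memory) (carry : ZMod 2)
    (source : List (Option Cell)) :
    Runs (2 * n + 2)
      (config (.forth m) 0 carry m.source
        { M with
          source := (List.ofFn r).map some ++ none :: source
          row := []
          left := List.ofFn c
          right := [] })
      (config (.forth m) 0 carry m.source
        { M with
          source := source
          target := (List.ofFn fun j => m.newCell (m.rowBit r c) (r j) (c j)).map some
            ++ none :: M.target
          row := []
          left := List.ofFn fun j => m.newColumn (m.rowBit r c) (r j) (c j)
          right := [] }) := by
  have h₁ := runs_forth m (List.ofFn fun j => (r j, c j)) M 0 carry source [] []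
  have h₂ := runs_back m (List.ofFn fun j => (r j, c j)).reverse { M with source := source }
    (m.rowBit r c) carry (none :: M.target) []
  simp only [List.map_ofFn, List.append_nil, List.sum_ofFn, List.length_ofFn, zero_add,
    List.map_reverse, List.reverse_reverse, List.length_reverse] at h₁ h₂ ⊢
  rw [show 2 * n + 2 = (n + 1) + (n + 1) by ring]
  exact h₁.trans h₂

theorem runs_sweep (rows done : List (Fin n → Cell)) (c : Fin n → Column) (M : Memory)
    (carry : ZMod 2) :
    Runs (rows.length * (2 * n + 2) + 1)
      (config (.forth m) 0 carry m.source
        { M with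
          source := rowsWord rows
          target := rowsWord done
          row := []
          left := List.ofFn c
          right := [] })
      (config (m.next carry) 0 carry m.source
        { M with
          source := []
          target := rowsWord ((m.sweepRows c rows).reverse ++ done)
          row := []
          left := List.ofFn (m.sweepColumns c rows)
          right := [] }) := by
  induction rows generalizing c done with
  | nil =>
    simp only [List.length_nil, Nat.zero_mul]
    exact Runs.of_step (by
      simp [config, program, Registers.clean, Mode.sweepRows, Mode.sweepColumns])
  | cons r rows ih =>
    have h₁ := runs_row m r c { M with target := rowsWord done } carry (rowsWord rows)
    have h₂ := ih ((fun j => m.newCell (m.rowBit r c) (r j) (c j)) :: done)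
      (fun j => m.newColumn (m.rowBit r c) (r j) (c j))
    rw [rowsWord_cons] at h₂ ⊢
    have h := h₁.trans h₂
    rw [List.length_cons, show (rows.length + 1) * (2 * n + 2) + 1
      = 2 * n + 2 + (rows.length * (2 * n + 2) + 1) by ring]
    simp only [Mode.sweepRows, Mode.sweepColumns, List.reverse_cons, List.append_assoc,
      List.singleton_append]
    exact h

end Sweep

/-! ### Linear algebra performed by the sweeps. -/

section Matrix

variable {k n : ℕ}

/-- The rows of a matrix together with the rows of its reduction. -/
def matrixRows (P W : Matrix (Fin k) (Fin n) (ZMod 2)) : List (Fin n → Cell) :=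
  List.ofFn fun a j => ⟨P a j, W a j⟩

@[simp] theorem length_matrixRows (P W : Matrix (Fin k) (Fin n) (ZMod 2)) :
    (matrixRows P W).length = k := by simp [matrixRows]

theorem sweepRows_gather (c : Fin n → Column) (rows : List (Fin n → Cell)) :
    Mode.gather.sweepRows c rows = rows := by
  induction rows generalizing c with
  | nil => rfl
  | cons r rows ih => rw [Mode.sweepRows, ih]; rfl

theorem sweepRows_final (c : Fin n → Column) (rows : List (Fin n → Cell)) :
    Mode.final.sweepRows c rows = rows := by
  induction rows generalizing c with
  | nil => rfl
  | cons r rows ih => rw [Mode.sweepRows, ih]; rfl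

theorem sweepRows_update (c : Fin n → Column) (rows : List (Fin n → Cell)) :
    Mode.update.sweepRows c rows = rows.map fun r j =>
      ⟨(r j).entry, (r j).reduced + (∑ l, (r l).reduced * (c l).pivot) * (c j).test⟩ := by
  induction rows generalizing c with
  | nil => rfl
  | cons r rows ih => rw [Mode.sweepRows, ih]; rfl

theorem sweepColumns_update (c : Fin n → Column) (rows : List (Fin n → Cell)) :
    Mode.update.sweepColumns c rows = c := by
  induction rows generalizing c with
  | nil => rfl
  | cons r rows ih => rw [Mode.sweepColumns, ih]; rfl

/-- The sweep alters only `gathered`, which the probe does not read, so every row bit can be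
computed from the initial columns. -/
theorem sweepColumns_gather (c : Fin n → Column) (rows : List (Fin n → Cell)) :
    Mode.gather.sweepColumns c rows = fun j => { c j with
      gathered := (c j).gathered
        + (rows.map fun r => (∑ l, (r l).entry * (c l).mark) * (r j).reduced).sum } := by
  induction rows generalizing c with
  | nil => simp [Mode.sweepColumns]
  | cons r rows ih =>
    rw [Mode.sweepColumns, ih]
    simp [Mode.newColumn, Mode.rowBit, Mode.probe, add_assoc]

theorem sweepColumns_final (c : Fin n → Column) (rows : List (Fin n → Cell)) :
    Mode.final.sweepColumns c rows = fun j => { c j with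
      count := (c j).count + (rows.map fun r => lift (r j).reduced
        + 2 * lift ((∑ l, (r l).entry * (c l).coin) * (r j).entry)).sum } := by
  induction rows generalizing c with
  | nil => simp [Mode.sweepColumns]
  | cons r rows ih =>
    rw [Mode.sweepColumns, ih]
    simp [Mode.newColumn, Mode.rowBit, Mode.probe, add_assoc]

/-- The vector whose only entry is at the first entry of a vector. -/
def pivotVec (g : Fin n → ZMod 2) (j : Fin n) : ZMod 2 := if ∀ l < j, g l = 0 then g j else 0

theorem pivotVec_succ (g : Fin (n + 1) → ZMod 2) (j : Fin n) :
    pivotVec g j.succ = if g 0 = 0 then pivotVec (fun l => g l.succ) j else 0 := by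
  unfold pivotVec
  by_cases h : g 0 = 0 <;> simp [Fin.forall_fin_succ, h]

/-- The indicator vector of an index. -/
def unitVec (n i : ℕ) (j : Fin n) : ZMod 2 := if (j : ℕ) = i then 1 else 0

/-- The offset p is the position of the list within all columns, so that the induction can pass to
tails. The mark moves from column i - 1 to column i; it leaves through the carry when there is no
column i. -/
theorem pivotPass_ofFn (c : Fin n → Column) (acc : ZMod 2) (i p : ℕ)
    (hc : ∀ j, (c j).mark = if (j : ℕ) + p + 1 = i then 1 else 0) :
    pivotPass acc (if p = i then 1 else 0) (List.ofFn c) =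
      (if n + p = i then 1 else 0, List.ofFn fun j =>
        ⟨(c j).coin, if (j : ℕ) + p = i then 1 else 0, 0,
          if acc = 0 then pivotVec (fun l => (c l).gathered) j else 0, (c j).gathered,
          (c j).count⟩) := by
  induction n generalizing acc p with
  | zero => simp [pivotPass]
  | succ n ih =>
    have h := ih (fun j => c j.succ) (if acc = 0 then (c 0).gathered else acc) (p + 1)
      (fun j => by rw [hc]; simp [add_comm, add_left_comm])
    have h0 : (c 0).mark = if p + 1 = i then 1 else 0 := by simpa using hc 0
    rw [List.ofFn_succ, pivotPass, h0, h, List.ofFn_succ]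
    have e : ∀ j : ℕ, j + (p + 1) = j + 1 + p := fun j => by ring
    simp only [e, Prod.mk.injEq, List.cons.injEq, Fin.val_zero, zero_add, Fin.val_succ, true_and,
      pivotVec_succ]
    refine ⟨by simp [pivotColumn, pivotVec], congrArg List.ofFn (funext fun j => ?_)⟩
    by_cases h1 : acc = 0 <;> simp [h1]

/-- The reductions of a matrix, with the test vectors for the next reductions. -/
def reduction (P : Matrix (Fin k) (Fin n) (ZMod 2)) :
    ℕ → Matrix (Fin k) (Fin n) (ZMod 2) × (Fin n → ZMod 2)
  | 0 => (P, 0)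
  | i + 1 =>
    let W := (reduction P i).1
      + Matrix.vecMulVec ((reduction P i).1 *ᵥ pivotVec (reduction P i).2) (reduction P i).2
    (W, (P *ᵥ unitVec n i) ᵥ* W)

/-- The columns before a pivot pass. -/
def startColumns (coin g pivot test : Fin n → ZMod 2) (i : ℕ) (j : Fin n) : Column :=
  ⟨coin j, if (j : ℕ) + 1 = i then 1 else 0, g j, pivot j, test j, 0⟩

/-- The columns after a pivot pass. -/
def pivotedColumns (coin g : Fin n → ZMod 2) (i : ℕ) (j : Fin n) : Column :=
  ⟨coin j, unitVec n i j, 0, pivotVec g j, g j, 0⟩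

theorem runs_pivot (coin g pivot test : Fin n → ZMod 2) (i : ℕ) (M : Memory) :
    Runs (2 * n + 2)
      (config .pivotForth 0 (if 0 = i then 1 else 0) false
        { M with left := List.ofFn (startColumns coin g pivot test i), right := [] })
      (config (.forth .update) 0 (if n = i then 1 else 0) false
        { M with left := List.ofFn (pivotedColumns coin g i), right := [] }) := by
  have h := runs_pivotForth (List.ofFn (startColumns coin g pivot test i)) M 0
    (if 0 = i then 1 else 0) []
  rw [pivotPass_ofFn _ _ _ _ (fun j => by simp [startColumns])] at h
  have h' := h.trans (runs_pivotBack _ { M with left := [] } _ [])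
  simp only [List.append_nil, List.reverse_reverse, List.length_reverse, List.length_ofFn, add_zero,
    if_true] at h'
  rw [show 2 * n + 2 = (n + 1) + (n + 1) by ring]
  exact h'

theorem runs_update (P W : Matrix (Fin k) (Fin n) (ZMod 2)) (coin g : Fin n → ZMod 2) (i : ℕ)
    (M : Memory) (carry : ZMod 2) :
    Runs (k * (2 * n + 2) + 1)
      (config (.forth .update) 0 carry false
        { M with
          source := []
          target := rowsWord (matrixRows P W).reverse
          row := []
          left := List.ofFn (pivotedColumns coin g i)
          right := [] })
      (config (Mode.update.next carry) 0 carry false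
        { M with
          source := rowsWord (matrixRows P (W + Matrix.vecMulVec (W *ᵥ pivotVec g) g))
          target := []
          row := []
          left := List.ofFn (pivotedColumns coin g i)
          right := [] }) := by
  have h := runs_sweep .update (matrixRows P W).reverse [] (pivotedColumns coin g i) M carry
  rw [sweepRows_update, sweepColumns_update] at h
  simp only [List.length_reverse, length_matrixRows, List.map_reverse, List.reverse_reverse,
    List.append_nil] at h
  -- The source of an update sweep is `rows true`, so source and target trade places when seen from
  -- `rows false`. The sweep also undoes the reversal of the rows.
  have e : ∀ (l : Label) (M' : Memory), config l 0 carry Mode.update.source M'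
      = config l 0 carry false { M' with source := M'.target, target := M'.source } :=
    fun l M' => congrArg _ (stacks_not M' false)
  rw [e, e, matrixRows, List.map_ofFn] at h
  exact h

theorem runs_gather (P W : Matrix (Fin k) (Fin n) (ZMod 2)) (coin g : Fin n → ZMod 2) (i : ℕ)
    (M : Memory) (carry : ZMod 2) :
    Runs (k * (2 * n + 2) + 1)
      (config (.forth .gather) 0 carry false
        { M with
          source := rowsWord (matrixRows P W)
          target := []
          row := []
          left := List.ofFn (pivotedColumns coin g i)
          right := [] })
      (config .pivotForth 0 carry false
        { M with
          source := []
          target := rowsWord (matrixRows P W).reverse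
          row := []
          left := List.ofFn
            (startColumns coin ((P *ᵥ unitVec n i) ᵥ* W) (pivotVec g) g (i + 1))
          right := [] }) := by
  have h := runs_sweep .gather (matrixRows P W) [] (pivotedColumns coin g i) M carry
  rw [sweepRows_gather, sweepColumns_gather] at h
  simp only [length_matrixRows, List.append_nil] at h
  have e : (fun j => { pivotedColumns coin g i j with
      gathered := (pivotedColumns coin g i j).gathered + ((matrixRows P W).map fun r =>
        (∑ l, (r l).entry * (pivotedColumns coin g i l).mark) * (r j).reduced).sum })
      = startColumns coin ((P *ᵥ unitVec n i) ᵥ* W) (pivotVec g) g (i + 1) := by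
    funext j
    simp [pivotedColumns, startColumns, matrixRows, List.map_ofFn, List.sum_ofFn, Matrix.vecMul,
      dotProduct, Matrix.mulVec, unitVec]
  rw [e] at h
  exact h

/-- The counters at the end of a run. -/
def finalCount (P W : Matrix (Fin k) (Fin n) (ZMod 2)) (coin : Fin n → ZMod 2) (j : Fin n) :
    ZMod 4 :=
  ∑ a, (lift (W a j) + 2 * lift ((P *ᵥ coin) a * P a j))

theorem runs_final (P W : Matrix (Fin k) (Fin n) (ZMod 2)) (coin g : Fin n → ZMod 2) (i : ℕ)
    (M : Memory) (carry : ZMod 2) :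
    Runs (k * (2 * n + 2) + 1)
      (config (.forth .final) 0 carry false
        { M with
          source := rowsWord (matrixRows P W)
          target := []
          row := []
          left := List.ofFn (pivotedColumns coin g i)
          right := [] })
      (config .collect 0 carry false
        { M with
          source := []
          target := rowsWord (matrixRows P W).reverse
          row := []
          left := List.ofFn fun j =>
            { pivotedColumns coin g i j with count := finalCount P W coin j }
          right := [] }) := by
  have h := runs_sweep .final (matrixRows P W) [] (pivotedColumns coin g i) M carry
  rw [sweepRows_final, sweepColumns_final] at h
  simp only [length_matrixRows, List.append_nil] at h
  have e : (fun j => { pivotedColumns coin g i j with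
      count := (pivotedColumns coin g i j).count + ((matrixRows P W).map fun r =>
        lift (r j).reduced + 2 * lift ((∑ l, (r l).entry * (pivotedColumns coin g i l).coin)
          * (r j).entry)).sum })
      = fun j => { pivotedColumns coin g i j with count := finalCount P W coin j } := by
    funext j
    simp [pivotedColumns, matrixRows, List.map_ofFn, List.sum_ofFn,
      dotProduct, Matrix.mulVec, finalCount]
  rw [e] at h
  exact h

/-- Here s counts the columns still to be tested. Each costs a pivot pass, an update and a gathering
sweep. The last pivot pass and update, at i = n, use the test vector of column n - 1, and the mark
that has left the columns ends the loop. The old `pivot` and `test` are arbitrary because a pivot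
pass overwrites them. -/
theorem runs_loop (P : Matrix (Fin k) (Fin n) (ZMod 2)) (coin : Fin n → ZMod 2) (M : Memory)
    (s i : ℕ) (hs : i + s = n) (pivot test : Fin n → ZMod 2) :
    Runs (s * (2 * (k * (2 * n + 2) + 1) + 2 * n + 2) + (2 * n + 2) + (k * (2 * n + 2) + 1))
      (config .pivotForth 0 (if 0 = i then 1 else 0) false
        { M with
          source := []
          target := rowsWord (matrixRows P (reduction P i).1).reverse
          row := []
          left := List.ofFn (startColumns coin (reduction P i).2 pivot test i)
          right := [] })
      (config (.forth .final) 0 1 false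
        { M with
          source := rowsWord (matrixRows P (reduction P (n + 1)).1)
          target := []
          row := []
          left := List.ofFn (pivotedColumns coin (reduction P n).2 n)
          right := [] }) := by
  induction s generalizing i pivot test with
  | zero =>
    obtain rfl : i = n := by omega
    have h₁ := runs_pivot coin (reduction P i).2 pivot test i
      { M with
        source := []
        target := rowsWord (matrixRows P (reduction P i).1).reverse
        row := [] }
    have h₂ := runs_update P (reduction P i).1 coin (reduction P i).2 i M
      (if i = i then 1 else 0)
    have h := h₁.trans h₂
    simp only [if_true, Mode.next] at h
    rw [Nat.zero_mul, Nat.zero_add]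
    exact h
  | succ s ih =>
    have hi : n ≠ i := by omega
    have h₁ := runs_pivot coin (reduction P i).2 pivot test i
      { M with
        source := []
        target := rowsWord (matrixRows P (reduction P i).1).reverse
        row := [] }
    have h₂ := runs_update P (reduction P i).1 coin (reduction P i).2 i M
      (if n = i then 1 else 0)
    have h₃ := runs_gather P (reduction P (i + 1)).1 coin (reduction P i).2 i M 0
    have h₄ := ih (i + 1) (by omega) (pivotVec (reduction P i).2) (reduction P i).2
    have h := h₁.trans h₂
    simp only [if_neg hi, Mode.next, zero_ne_one, if_false] at h
    rw [if_neg (Nat.succ_ne_zero i).symm] at h₄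
    have h' := (h.trans h₃).trans h₄
    rw [show (s + 1) * (2 * (k * (2 * n + 2) + 1) + 2 * n + 2) + (2 * n + 2)
        + (k * (2 * n + 2) + 1) = 2 * n + 2 + (k * (2 * n + 2) + 1) + (k * (2 * n + 2) + 1)
        + (s * (2 * (k * (2 * n + 2) + 1) + 2 * n + 2) + (2 * n + 2) + (k * (2 * n + 2) + 1)) by
      ring]
    exact h'

end Matrix

/-! ### The complete run and its time bound. -/

theorem initList_machine (w : List InputSymbol) :
    initList machine w = config .skip 0 0 false ⟨w, [], [], [], [], [], []⟩ := by
  refine congrArg (TM2.Cfg.mk (some Label.skip) (Registers.clean 0 0)) (funext fun k => ?_)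
  rcases k with _ | _ | (_ | _) | _ | _ | _ <;> rfl

theorem haltList_machine (w : List Bool) :
    haltList machine w
      = ⟨none, .clean 0 0, (⟨[], w, [], [], [], [], []⟩ : Memory).stacks false⟩ := by
  refine congrArg (TM2.Cfg.mk none (Registers.clean 0 0)) (funext fun k => ?_)
  rcases k with _ | _ | (_ | _) | _ | _ | _ <;> rfl

theorem length_rowsWord {n : ℕ} (rows : List (Fin n → Cell)) :
    (rowsWord rows).length = rows.length * (n + 1) := by
  induction rows with
  | nil => simp
  | cons r rows ih => rw [rowsWord_cons]; simp [ih]; ring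

theorem symbolBit_decide (x : ZMod 2) : symbolBit (.bit (decide (x = 1))) = x := by
  revert x; decide

section Run

variable {k n L : ℕ}

/-- The vector of the first `n` coin flips, the last one first. -/
def coinVec (hn : n ≤ L) (r : Fin L → Bool) (j : Fin n) : ZMod 2 :=
  symbolBit (.bit (r (Fin.castLE hn j.rev)))

/-- The input of the machine. -/
def inputWord (header : List Bool) (P : Matrix (Fin k) (Fin n) (ZMod 2)) (r : Fin L → Bool) :
    List InputSymbol :=
  header.map .bit ++ .semicolon :: (List.replicate n (.bit true) ++ .semicolon ::
    (((List.ofFn fun i j => decide (P i j = 1)).flatMap fun r =>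
      (List.ofFn r).map .bit ++ [.comma]) ++ .semicolon :: (List.ofFn r).map .bit))

/-- The output of the machine. -/
def outputWord (P : Matrix (Fin k) (Fin n) (ZMod 2)) (coin : Fin n → ZMod 2) : List Bool :=
  List.ofFn fun j => decide (2 ≤ (finalCount P (reduction P (n + 1)).1 coin j).val)

/-- The number of steps that the machine makes. -/
def runTime (h k n L : ℕ) : ℕ :=
  (h + 1) + (n + 1) + (k * (2 * n + 2) + 1) + (n + 1) + (L - n + 1)
    + (n * (2 * (k * (2 * n + 2) + 1) + 2 * n + 2) + (2 * n + 2) + (k * (2 * n + 2) + 1))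
    + (k * (2 * n + 2) + 1) + (n + 1) + (n + 1) + (k * (n + 1) + 1)

theorem reverse_take_coins (hn : n ≤ L) (r : Fin L → Bool) :
    (((List.ofFn r).take n).map fun b => { Column.blank with coin := symbolBit (.bit b) }).reverse
      = List.ofFn (startColumns (coinVec hn r) 0 0 0 0) := by
  refine List.ext_getElem (by simpa using hn) fun i h₁ h₂ => ?_
  have : min n L = n := min_eq_left hn
  simp [startColumns, coinVec, Column.blank, Fin.castLE, Fin.rev, this, Nat.sub_sub, Nat.add_comm]

/-- The header, which encodes m, has no effect on the output; `outputProb_of_pi_div_four` shows that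
it need not have any. -/
theorem runs_machine (header : List Bool) (P : Matrix (Fin k) (Fin n) (ZMod 2)) (hn : n ≤ L)
    (r : Fin L → Bool) :
    Runs (runTime header.length k n L) (initList machine (inputWord header P r))
      (haltList machine (outputWord P (coinVec hn r))) := by
  rw [initList_machine, haltList_machine]
  have h₁ := runs_skip header (List.replicate n (.bit true) ++ .semicolon ::
    (((List.ofFn fun i j => decide (P i j = 1)).flatMap fun r =>
      (List.ofFn r).map .bit ++ [.comma]) ++ .semicolon :: (List.ofFn r).map .bit))
    ⟨[], [], [], [], [], [], []⟩
  have h₂ := runs_readWidth n (((List.ofFn fun i j => decide (P i j = 1)).flatMap fun r =>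
      (List.ofFn r).map .bit ++ [.comma]) ++ .semicolon :: (List.ofFn r).map .bit)
    ⟨[], [], [], [], [], [], []⟩ []
  have h₃ := runs_load (List.ofFn fun i j => decide (P i j = 1)) ((List.ofFn r).map .bit)
    ⟨[], [], [], [], [], [], List.replicate n .blank⟩ []
  have h₄ := runs_flip ((List.ofFn r).take n) (((List.ofFn r).drop n).map .bit)
    ⟨[], [], [], rowsWord (matrixRows P P).reverse, [], [], []⟩ []
  have h₅ := runs_drain (((List.ofFn r).drop n).map .bit)
    ⟨[], [], [], rowsWord (matrixRows P P).reverse, [],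
      List.ofFn (startColumns (coinVec hn r) 0 0 0 0), []⟩
  have h₆ := runs_loop P (coinVec hn r) ⟨[], [], [], [], [], [], []⟩ n 0 (by omega) 0 0
  have h₇ := runs_final P (reduction P (n + 1)).1 (coinVec hn r) (reduction P n).2 n
    ⟨[], [], [], [], [], [], []⟩ 1
  have h₈ := runs_collect (List.ofFn fun j =>
      { pivotedColumns (coinVec hn r) (reduction P n).2 n j with
        count := finalCount P (reduction P (n + 1)).1 (coinVec hn r) j })
    ⟨[], [], [], rowsWord (matrixRows P (reduction P (n + 1)).1).reverse, [], [], []⟩ 1 []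
  have h₉ := runs_write (List.ofFn fun j =>
      { pivotedColumns (coinVec hn r) (reduction P n).2 n j with
        count := finalCount P (reduction P (n + 1)).1 (coinVec hn r) j }).reverse
    ⟨[], [], [], rowsWord (matrixRows P (reduction P (n + 1)).1).reverse, [], [], []⟩ 1 []
  have h₁₀ := runs_clear (rowsWord (matrixRows P (reduction P (n + 1)).1).reverse)
    ⟨[], outputWord P (coinVec hn r), [], [], [], [], []⟩ 1
  simp only [List.append_nil, List.length_ofFn, List.map_ofFn, Function.comp_def,
    reverse_take_coins hn, ← List.map_append, List.take_append_drop, List.length_take,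
    min_eq_left hn, List.length_map, List.length_drop, List.map_reverse, List.reverse_reverse,
    List.length_reverse, length_rowsWord, length_matrixRows, bitCell, symbolBit_decide,
    if_true] at h₁ h₂ h₃ h₄ h₅ h₆ h₇ h₈ h₉ h₁₀
  simp only [inputWord, List.map_ofFn, Function.comp_def]
  exact ((((((((h₁.trans h₂).trans h₃).trans h₄).trans h₅).trans h₆).trans h₇).trans h₈).trans
    h₉).trans h₁₀

/-- About 2n sweeps over k rows of n entries dominate, hence a cubic bound; the constant 50 is
generous. -/
theorem runTime_le {h k n L N : ℕ} (hh : h ≤ N) (hk : k ≤ N) (hn : n ≤ N) (hL : L ≤ N) :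
    runTime h k n L ≤ 50 * (N + 1) ^ 3 := by
  have h₁ : runTime h k n L ≤ (N + 1) + (N + 1) + (N * (2 * N + 2) + 1) + (N + 1) + (N + 1)
    + (N * (2 * (N * (2 * N + 2) + 1) + 2 * N + 2) + (2 * N + 2) + (N * (2 * N + 2) + 1))
    + (N * (2 * N + 2) + 1) + (N + 1) + (N + 1) + (N * (N + 1) + 1) := by
    unfold runTime
    gcongr
    omega
  refine h₁.trans ?_
  nlinarith [Nat.zero_le N, Nat.zero_le (N ^ 2), Nat.zero_le (N ^ 3)]

end Run

theorem encode_append (Q : QuarterProgram) {L : ℕ} (r : Fin L → Bool) :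
    Q.encode ++ InputSymbol.semicolon :: (List.ofFn fun i => InputSymbol.bit (r i))
      = inputWord (decide (Q.m < 0) :: Computability.encodeNat Q.m.natAbs) Q.P r := by
  simp [QuarterProgram.encode, inputWord, bitList, List.flatMap, List.map_ofFn, Function.comp_def]

/-- The width is written in unary, so one coin for each symbol of the encoding is enough. -/
theorem width_le_length_encode (Q : QuarterProgram) : Q.n ≤ Q.encode.length := by
  simp [QuarterProgram.encode]; omega

theorem program_le_length_encode (Q : QuarterProgram) : Q.k ≤ Q.encode.length := by
  have : Q.k ≤ (List.ofFn fun i =>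
      (bitList (Q.P i)).map InputSymbol.bit ++ [InputSymbol.comma]).flatten.length := by
    simp [List.length_flatten, List.map_ofFn, Function.comp_def, bitList, Nat.mul_succ]
  simp only [QuarterProgram.encode, List.length_append, List.length_cons]
  omega

theorem header_le_length_encode (Q : QuarterProgram) :
    (decide (Q.m < 0) :: Computability.encodeNat Q.m.natAbs).length ≤ Q.encode.length := by
  simp only [QuarterProgram.encode, List.length_append, List.length_map]
  omega

/-- The machine computes a function of the program and the coin flips in polynomial time if its
outputs represent the values of the function. -/
def computableInPolyTime (q : Polynomial ℕ)
    (hq : ∀ Q : QuarterProgram, Q.n ≤ q.eval Q.encode.length)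
    (sample : (Q : QuarterProgram) → (Fin (q.eval Q.encode.length) → Bool) → BitVec2 Q.n)
    (hs : ∀ Q r, bitList (sample Q r) = outputWord Q.P (coinVec (hq Q) r)) :
    TM2ComputableInPolyTime
      (α := Σ Q : QuarterProgram, (Fin (q.eval Q.encode.length) → Bool)) (β := List Bool)
      (fun w => w.1.encode ++ InputSymbol.semicolon :: List.ofFn fun i => InputSymbol.bit (w.2 i))
      (fun l => l) (fun w => bitList (sample w.1 w.2)) where
  tm := machine
  inputAlphabet := Equiv.refl _
  outputAlphabet := Equiv.refl _
  time := 50 * (Polynomial.X + 1) ^ 3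
  outputsFun w :=
    { steps := runTime (decide (w.1.m < 0) :: Computability.encodeNat w.1.m.natAbs).length
        w.1.k w.1.n (q.eval w.1.encode.length)
      evals_in_steps := by
        have h := runs_machine (decide (w.1.m < 0) :: Computability.encodeNat w.1.m.natAbs)
          w.1.P (hq w.1) w.2
        -- The alphabets are identified with those of the stacks by `Equiv.refl`, which appears as a
        -- map by the identity.
        rw [← encode_append, ← hs, ← List.map_id (bitList _), ← List.map_id (w.1.encode ++ _)] at h
        exact h
      steps_le_m := by
        have h₁ := header_le_length_encode w.1
        have h₂ := program_le_length_encode w.1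
        have h₃ := width_le_length_encode w.1
        have h₄ : (w.1.encode ++ InputSymbol.semicolon ::
            List.ofFn fun i => InputSymbol.bit (w.2 i)).length
            = w.1.encode.length + (q.eval w.1.encode.length + 1) := by simp
        rw [h₄]
        simp only [Polynomial.eval_mul, Polynomial.eval_pow, Polynomial.eval_add,
          Polynomial.eval_X, Polynomial.eval_one, Polynomial.eval_ofNat]
        exact runTime_le (by omega) (by omega) (by omega) (by omega) }

/-! ### Character sums. -/

section Characters

/-- The nontrivial character of the field with two elements. -/
def sign (x : ZMod 2) : ℂ := if x = 0 then 1 else -1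

@[simp] theorem sign_zero : sign 0 = 1 := if_pos rfl

@[simp] theorem sign_one : sign 1 = -1 := if_neg one_ne_zero

theorem zmod_two_cases (x : ZMod 2) : x = 0 ∨ x = 1 := by revert x; decide

theorem sign_add (x y : ZMod 2) : sign (x + y) = sign x * sign y := by
  have h : (1 + 1 : ZMod 2) = 0 := by decide
  rcases zmod_two_cases x with rfl | rfl <;> rcases zmod_two_cases y with rfl | rfl <;> simp [h]

theorem sign_sum {ι : Type*} (s : Finset ι) (f : ι → ZMod 2) :
    sign (∑ i ∈ s, f i) = ∏ i ∈ s, sign (f i) := by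
  classical
  induction s using Finset.induction_on with
  | empty => simp
  | insert a s ha ih => rw [Finset.sum_insert ha, Finset.prod_insert ha, sign_add, ih]

variable {n : ℕ}

theorem add_self_vec {ι : Type*} (v : ι → ZMod 2) : v + v = 0 := by
  funext j; exact CharTwo.add_self_eq_zero _

theorem eq_add_vec_iff {ι : Type*} (u v w : ι → ZMod 2) : u = v + w ↔ v = u + w := by
  constructor <;> rintro rfl <;> rw [add_assoc, add_self_vec, add_zero]

/-- If u has the entry 1 at j, the permutation `τ j` negates every term, so the sum equals its own
negative. The index type is kept general so as to cover coin sequences longer than n. -/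
theorem sum_sign_dotProduct {α : Type*} [Fintype α] (f : α → Fin n → ZMod 2) (τ : Fin n → α ≃ α)
    (hτ : ∀ j a, f (τ j a) = f a + Pi.single j 1) (u : Fin n → ZMod 2) :
    ∑ a, sign (u ⬝ᵥ f a) = if u = 0 then (Fintype.card α : ℂ) else 0 := by
  split_ifs with h
  · simp [h]
  · obtain ⟨j, hj⟩ := Function.ne_iff.1 h
    have hj : u j = 1 := (zmod_two_cases _).resolve_left hj
    have e : ∑ a, sign (u ⬝ᵥ f a) = -∑ a, sign (u ⬝ᵥ f a) := by
      rw [← Finset.sum_neg_distrib, ← Equiv.sum_comp (τ j)]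
      simp [hτ, dotProduct_add, sign_add, hj]
    exact self_eq_neg.1 e

theorem sum_sign_vec (u : Fin n → ZMod 2) :
    ∑ y : Fin n → ZMod 2, sign (u ⬝ᵥ y) = if u = 0 then (2 : ℂ) ^ n else 0 := by
  rw [sum_sign_dotProduct (fun y => y) (fun j => Equiv.addRight (Pi.single j 1))
    (fun j a => rfl)]
  simp [ZMod.card]

theorem sum_sign_coinVec {L : ℕ} (hn : n ≤ L) (u : Fin n → ZMod 2) :
    ∑ r : Fin L → Bool, sign (u ⬝ᵥ coinVec hn r) = if u = 0 then (2 : ℂ) ^ L else 0 := by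
  have h := sum_sign_dotProduct (coinVec hn)
    (fun j => Function.Involutive.toPerm
      (fun r i => if i = Fin.castLE hn j.rev then !(r i) else r i)
      (fun r => by funext i; by_cases h : i = Fin.castLE hn j.rev <;> simp [h])) ?_ u
  · rw [h]; simp
  · intro j r
    funext l
    by_cases h : l = j
    · subst h
      have : ∀ b : Bool, symbolBit (.bit !b) = symbolBit (.bit b) + 1 := by decide
      simp [coinVec]
      rw [← this]; congr 2; exact if_pos rfl
    · have h' : Fin.castLE hn l.rev ≠ Fin.castLE hn j.rev := by
        rw [Ne, (Fin.castLE_injective hn).eq_iff, Fin.rev_inj]; exact h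
      simp [coinVec, h]
      congr 2; exact if_neg h'

end Characters

/-! ### Amplitudes as Fourier sums; multiples of π and odd multiples of π/2. -/

section Amplitude

variable {n k : ℕ}

/-- The character table of the group of bit strings. -/
def characterTable (n : ℕ) : Matrix (BitVec2 n) (BitVec2 n) ℂ := Matrix.of fun x y => sign (x ⬝ᵥ y)

theorem characterTable_mul_self :
    characterTable n * characterTable n = (2 : ℂ) ^ n • (1 : Matrix (BitVec2 n) (BitVec2 n) ℂ) := by
  ext x z
  have h : ∀ y : BitVec2 n, sign (x ⬝ᵥ y) * sign (y ⬝ᵥ z) = sign ((x + z) ⬝ᵥ y) := fun y => by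
    rw [add_dotProduct, sign_add, dotProduct_comm y z]
  have h0 : x + z = 0 ↔ x = z := by
    rw [eq_comm, eq_add_vec_iff, zero_add]
  simp only [characterTable, Matrix.mul_apply, Matrix.of_apply, h, sum_sign_vec, h0,
    Matrix.smul_apply, Matrix.one_apply, smul_eq_mul, mul_ite, mul_one, mul_zero]

theorem pauliXProduct_apply (p x y : BitVec2 n) :
    pauliXProduct p x y = if x = y + p then 1 else 0 := by
  have h : ∀ a b c : ZMod 2, (if a = 1 then pauliX else 1) b c = if b = c + a then 1 else 0 := by
    intro a b c
    rcases zmod_two_cases a with rfl | rfl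
    · simp [Matrix.one_apply]
    · have : b = c + 1 ↔ ¬ b = c := by revert b c; decide
      simp only [if_true, pauliX, Matrix.of_apply, this]
      split_ifs <;> simp_all
  simp only [pauliXProduct, Matrix.of_apply, h, Finset.prod_ite_zero, funext_iff]
  simp

/-- The operator translates by p, and a character is an eigenvector of every translation. -/
theorem pauliXProduct_mul_characterTable (p : BitVec2 n) :
    pauliXProduct p * characterTable n
      = characterTable n * Matrix.diagonal fun c => sign (p ⬝ᵥ c) := by
  ext x c
  rw [Matrix.mul_diagonal]
  simp only [Matrix.mul_apply, pauliXProduct_apply, eq_add_vec_iff x]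
  simp [characterTable, add_dotProduct, sign_add]

/-- The energy of a character. -/
def energy (θ : ℝ) (P : Matrix (Fin k) (Fin n) (ZMod 2)) (c : BitVec2 n) : ℂ :=
  ∑ i, θ * sign ((P *ᵥ c) i)

theorem hamiltonian_mul_characterTable (θ : ℝ) (P : Matrix (Fin k) (Fin n) (ZMod 2)) :
    (XProgram.constantAction θ P).hamiltonian * characterTable n
      = characterTable n * Matrix.diagonal (energy θ P) := by
  have h : (XProgram.constantAction θ P).hamiltonian = ∑ i, (θ : ℂ) • pauliXProduct (P i) := by
    simp [XProgram.hamiltonian, XProgram.constantAction, List.map_ofFn, List.sum_ofFn]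
  have e : Matrix.diagonal (energy θ P)
      = ∑ i, (θ : ℂ) • Matrix.diagonal fun c => sign (P i ⬝ᵥ c) := by
    ext x y
    by_cases hxy : x = y
    · subst hxy; simp [Matrix.sum_apply, energy, Matrix.mulVec]
    · simp [Matrix.sum_apply, hxy]
  rw [h, e, Finset.sum_mul, Finset.mul_sum]
  refine Finset.sum_congr rfl fun i _ => ?_
  rw [Matrix.smul_mul, pauliXProduct_mul_characterTable, Matrix.mul_smul]

theorem exp_hamiltonian_apply (θ : ℝ) (P : Matrix (Fin k) (Fin n) (ZMod 2)) (x : BitVec2 n) :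
    NormedSpace.exp (Complex.I • (XProgram.constantAction θ P).hamiltonian) x 0
      = (2 ^ n : ℂ)⁻¹ * ∑ c, sign (x ⬝ᵥ c) * Complex.exp (Complex.I * energy θ P c) := by
  have h2 : (2 : ℂ) ^ n ≠ 0 := pow_ne_zero n two_ne_zero
  have hr : characterTable n * ((2 ^ n : ℂ)⁻¹ • characterTable n) = 1 := by
    rw [Matrix.mul_smul, characterTable_mul_self, smul_smul, inv_mul_cancel₀ h2, one_smul]
  have hu : IsUnit (characterTable n) := ⟨⟨_, _, hr, mul_eq_one_comm.1 hr⟩, rfl⟩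
  have hi : (characterTable n)⁻¹ = (2 ^ n : ℂ)⁻¹ • characterTable n := Matrix.inv_eq_right_inv hr
  have e : Complex.I • (XProgram.constantAction θ P).hamiltonian
      = characterTable n * Matrix.diagonal (fun c => Complex.I * energy θ P c)
        * (characterTable n)⁻¹ := by
    have : Matrix.diagonal (fun c => Complex.I * energy θ P c)
        = Complex.I • Matrix.diagonal (energy θ P) := by
      rw [← Matrix.diagonal_smul]; rfl
    rw [this, Matrix.mul_smul, ← hamiltonian_mul_characterTable, Matrix.smul_mul, mul_assoc, hi, hr,
      mul_one]
  rw [e, Matrix.exp_conj _ _ hu, Matrix.exp_diagonal, hi, Matrix.mul_smul, Matrix.smul_apply,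
    Matrix.mul_apply, smul_eq_mul]
  simp [Matrix.mul_diagonal, characterTable, Pi.coe_exp, Complex.exp_eq_exp_ℂ]

/-- The factor of the amplitude that belongs to a bit. -/
def phase (z : ℂ) (y : ZMod 2) : ℂ := if y = 0 then 1 else z

/-- For a bit y, sign y = 1 - 2y, so each row contributes exp(iθ) times the y-th power of exp(-2iθ).
The first factor becomes a global phase. -/
theorem exp_energy (θ : ℝ) (P : Matrix (Fin k) (Fin n) (ZMod 2)) (c : BitVec2 n) :
    Complex.exp (Complex.I * energy θ P c) = Complex.exp (Complex.I * θ) ^ k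
      * ∏ i, phase (Complex.exp (-(2 * θ * Complex.I))) ((P *ᵥ c) i) := by
  have h : ∀ y : ZMod 2, Complex.exp (Complex.I * (θ * sign y))
      = Complex.exp (Complex.I * θ) * phase (Complex.exp (-(2 * θ * Complex.I))) y := by
    intro y
    rcases zmod_two_cases y with rfl | rfl
    · simp [phase]
    · simp only [sign_one, phase, one_ne_zero, if_false, ← Complex.exp_add]
      congr 1; ring
  rw [energy, Finset.mul_sum, Complex.exp_sum, Finset.prod_congr rfl fun i _ => h _,
    Finset.prod_mul_distrib]
  simp

theorem outputProb_constantAction (θ : ℝ) (P : Matrix (Fin k) (Fin n) (ZMod 2)) (x : BitVec2 n) :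
    (XProgram.constantAction θ P).outputProb x = ((2 : ℝ) ^ n)⁻¹ ^ 2 *
      ‖∑ c, sign (x ⬝ᵥ c) * ∏ i, phase (Complex.exp (-(2 * θ * Complex.I))) ((P *ᵥ c) i)‖ ^ 2 := by
  have h : ∑ c, sign (x ⬝ᵥ c) * Complex.exp (Complex.I * energy θ P c)
      = Complex.exp (Complex.I * θ) ^ k * ∑ c, sign (x ⬝ᵥ c)
        * ∏ i, phase (Complex.exp (-(2 * θ * Complex.I))) ((P *ᵥ c) i) := by
    rw [Finset.mul_sum]
    refine Finset.sum_congr rfl fun c _ => ?_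
    rw [exp_energy]; ring
  rw [XProgram.outputProb, exp_hamiltonian_apply, h, norm_mul, norm_mul, norm_pow,
    mul_comm Complex.I, Complex.norm_exp_ofReal_mul_I]
  simp [mul_pow]

theorem collisionEntropy_indicator (s : BitVec2 n) (D : BitVec2 n → ℝ)
    (h : ∀ x, D x = if x = s then 1 else 0) : collisionEntropy D = 0 := by
  simp [collisionEntropy, h]

/-- By orthogonality, the Fourier transform of a character is concentrated at one point. -/
theorem outputProb_of_phase_eq_sign (θ : ℝ) (P : Matrix (Fin k) (Fin n) (ZMod 2)) (s x : BitVec2 n)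
    (h : ∀ c, ∏ i, phase (Complex.exp (-(2 * θ * Complex.I))) ((P *ᵥ c) i) = sign (s ⬝ᵥ c)) :
    (XProgram.constantAction θ P).outputProb x = if x = s then 1 else 0 := by
  have e : ∑ c, sign (x ⬝ᵥ c) * sign (s ⬝ᵥ c) = if x = s then (2 : ℂ) ^ n else 0 := by
    have h0 : x + s = 0 ↔ x = s := by
      rw [eq_comm, eq_add_vec_iff, zero_add]
    simp_rw [← sign_add, ← add_dotProduct, sum_sign_vec, h0]
  rw [outputProb_constantAction]
  simp_rw [h, e]
  split_ifs
  · rw [norm_pow, Complex.norm_ofNat, ← mul_pow, inv_mul_cancel₀ (by positivity), one_pow]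
  · simp

theorem exp_odd_mul_pi (m : ℤ) : Complex.exp (-((2 * m + 1) * Real.pi * Complex.I)) = -1 := by
  rw [show -((2 * m + 1) * Real.pi * Complex.I)
    = ((-m - 1 : ℤ) : ℂ) * (2 * Real.pi * Complex.I) + Real.pi * Complex.I by push_cast; ring,
    Complex.exp_add, Complex.exp_int_mul_two_pi_mul_I, Complex.exp_pi_mul_I, one_mul]

theorem outputProb_of_pi (θ : ℝ) (P : Matrix (Fin k) (Fin n) (ZMod 2)) (m : ℤ)
    (hθ : θ = m * Real.pi) (x : BitVec2 n) :
    (XProgram.constantAction θ P).outputProb x = if x = 0 then 1 else 0 := by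
  refine outputProb_of_phase_eq_sign θ P 0 x fun c => ?_
  have : Complex.exp (-(2 * θ * Complex.I)) = 1 := by
    rw [hθ, show -(2 * ((m * Real.pi : ℝ) : ℂ) * Complex.I)
      = ((-m : ℤ) : ℂ) * (2 * Real.pi * Complex.I) by push_cast; ring,
      Complex.exp_int_mul_two_pi_mul_I]
  simp [this, phase]

theorem outputProb_of_pi_div_two (θ : ℝ) (P : Matrix (Fin k) (Fin n) (ZMod 2)) (m : ℤ)
    (hθ : θ = (2 * (m : ℝ) + 1) * (Real.pi / 2)) (x : BitVec2 n) :
    (XProgram.constantAction θ P).outputProb x = if x = ∑ i, P i then 1 else 0 := by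
  refine outputProb_of_phase_eq_sign θ P _ x fun c => ?_
  have : Complex.exp (-(2 * θ * Complex.I)) = -1 := by
    rw [← exp_odd_mul_pi m, hθ]; push_cast; ring_nf
  have e : (∑ i, P i) ⬝ᵥ c = ∑ i, (P *ᵥ c) i := by
    have h : ∀ j, (∑ i, P i) j = ∑ i, P i j := fun j => Finset.sum_apply j Finset.univ fun i => P i
    simp only [dotProduct, Matrix.mulVec, h, Finset.sum_mul]
    exact Finset.sum_comm
  rw [this, e, sign_sum]
  rfl

end Amplitude

/-! ### Correctness of the reduction. -/

section Reduction

variable {k n : ℕ}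

theorem dotProduct_pivotVec (g : Fin n → ZMod 2) (hg : g ≠ 0) : g ⬝ᵥ pivotVec g = 1 := by
  induction n with
  | zero => exact absurd (Subsingleton.elim g 0) hg
  | succ n ih =>
    have h0 : pivotVec g 0 = g 0 := by simp [pivotVec]
    rw [dotProduct, Fin.sum_univ_succ, h0]
    simp only [pivotVec_succ]
    rcases zmod_two_cases (g 0) with h | h
    · have hg' : (fun l : Fin n => g l.succ) ≠ 0 := fun e =>
        hg (funext fun j => Fin.cases h (fun l => congrFun e l) j)
      simpa [h, dotProduct] using ih _ hg'
    · simp [h]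

theorem mulVec_unitVec (P : Matrix (Fin k) (Fin n) (ZMod 2)) (i : Fin n) :
    P *ᵥ unitVec n i = fun a => P a i := by
  funext a
  simp [Matrix.mulVec, dotProduct, unitVec, Fin.val_inj]

theorem dotProduct_mulVec_eq_zero (P : Matrix (Fin k) (Fin n) (ZMod 2)) (e : BitVec2 n)
    (he : (Pᵀ * P) *ᵥ e = 0) (y : Fin n → ZMod 2) : (P *ᵥ y) ⬝ᵥ (P *ᵥ e) = 0 := by
  rw [← Matrix.mulVec_mulVec] at he
  rw [dotProduct_comm, Matrix.dotProduct_mulVec, ← Matrix.mulVec_transpose, he, zero_dotProduct]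

theorem vecMul_add_vecMulVec (W : Matrix (Fin k) (Fin n) (ZMod 2)) (t : Fin k → ZMod 2)
    (p g : Fin n → ZMod 2) :
    t ᵥ* (W + Matrix.vecMulVec (W *ᵥ p) g) = t ᵥ* W + ((t ᵥ* W) ⬝ᵥ p) • g := by
  rw [Matrix.vecMul_add, Matrix.vecMul_vecMulVec, Matrix.dotProduct_mulVec]

theorem reduction_snd_succ (P : Matrix (Fin k) (Fin n) (ZMod 2)) (i : ℕ) :
    (reduction P (i + 1)).2 = (P *ᵥ unitVec n i) ᵥ* (reduction P (i + 1)).1 := rfl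

theorem reduction_fst_succ (P : Matrix (Fin k) (Fin n) (ZMod 2)) (i : ℕ) :
    (reduction P (i + 1)).1 = (reduction P i).1
      + Matrix.vecMulVec ((reduction P i).1 *ᵥ pivotVec (reduction P i).2) (reduction P i).2 := rfl

/-- An update multiplies V on the right by 1 + p gᵀ. If PᵀPe = 0, then g·e is the product of a
column of P with We = Pe, hence zero, so e remains fixed. -/
theorem exists_reduction_eq_mul (P : Matrix (Fin k) (Fin n) (ZMod 2)) (i : ℕ) :
    ∃ V : Matrix (Fin n) (Fin n) (ZMod 2), (reduction P i).1 = P * V ∧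
      ∀ e, (Pᵀ * P) *ᵥ e = 0 → V *ᵥ e = e := by
  induction i with
  | zero => exact ⟨1, by simp [reduction], by simp⟩
  | succ i ih =>
    obtain ⟨V, hV, he⟩ := ih
    refine ⟨V + Matrix.vecMulVec (V *ᵥ pivotVec (reduction P i).2) (reduction P i).2, ?_, ?_⟩
    · rw [reduction_fst_succ, hV, Matrix.mul_add, Matrix.mul_vecMulVec, Matrix.mulVec_mulVec]
    · intro e h
      have hg : (reduction P i).2 ⬝ᵥ e = 0 := by
        cases i with
        | zero => simp [reduction]
        | succ i =>
          rw [reduction_snd_succ, hV, ← Matrix.dotProduct_mulVec, ← Matrix.mulVec_mulVec, he e h,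
            dotProduct_mulVec_eq_zero P e h]
      rw [Matrix.add_mulVec, he e h, Matrix.vecMulVec_mulVec, hg]
      simp

/-- An update with test vector g = tᵀW replaces tᵀW by g + (g·p) g = 0, as g·p = 1 unless g = 0;
products that already vanish stay zero. Column j is tested at stage j + 1 and cleared at stage j +
2, so n + 1 stages are needed for all columns. -/
theorem vecMul_reduction (P : Matrix (Fin k) (Fin n) (ZMod 2)) (i j : ℕ) (hj : j + 1 < i) :
    (P *ᵥ unitVec n j) ᵥ* (reduction P i).1 = 0 := by
  induction i with
  | zero => omega
  | succ i ih =>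
    rw [reduction_fst_succ, vecMul_add_vecMulVec]
    rcases Nat.lt_succ_iff_lt_or_eq.1 hj with h | rfl
    · rw [ih h]; simp
    · rw [← reduction_snd_succ]
      by_cases h0 : (reduction P (j + 1)).2 = 0
      · rw [h0]; simp
      · rw [dotProduct_pivotVec _ h0, one_smul, add_self_vec]

theorem transpose_mul_reduction (P : Matrix (Fin k) (Fin n) (ZMod 2)) :
    Pᵀ * (reduction P (n + 1)).1 = 0 := by
  ext i j
  have h := congrFun (vecMul_reduction P (n + 1) i (by omega)) j
  rw [mulVec_unitVec] at h
  exact h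

theorem reduction_transpose_mul_reduction (P : Matrix (Fin k) (Fin n) (ZMod 2)) :
    (reduction P (n + 1)).1ᵀ * (reduction P (n + 1)).1 = 0 := by
  obtain ⟨V, hV, -⟩ := exists_reduction_eq_mul P (n + 1)
  nth_rw 1 [hV]
  rw [Matrix.transpose_mul, Matrix.mul_assoc, transpose_mul_reduction, Matrix.mul_zero]

theorem reduction_mulVec (P : Matrix (Fin k) (Fin n) (ZMod 2)) (e : BitVec2 n)
    (he : (Pᵀ * P) *ᵥ e = 0) : (reduction P (n + 1)).1 *ᵥ e = P *ᵥ e := by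
  obtain ⟨V, hV, h⟩ := exists_reduction_eq_mul P (n + 1)
  rw [hV, ← Matrix.mulVec_mulVec, h e he]

end Reduction

/-! ### The Hamming weight modulo four as a quadratic form. -/

section Weight

variable {k n : ℕ}

/-- The Hamming weight of a bit string, modulo four. -/
def weight (v : Fin k → ZMod 2) : ZMod 4 := ∑ a, lift (v a)

theorem lift_add (x y : ZMod 2) : lift (x + y) = lift x + lift y + 2 * lift (x * y) := by
  revert x y; decide

theorem two_mul_lift_add (x y : ZMod 2) : 2 * lift (x + y) = 2 * lift x + 2 * lift y := by
  revert x y; decide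

@[simp] theorem lift_zero : lift 0 = 0 := by decide

theorem two_mul_lift_sum {ι : Type*} (s : Finset ι) (f : ι → ZMod 2) :
    2 * lift (∑ i ∈ s, f i) = ∑ i ∈ s, 2 * lift (f i) := by
  classical
  induction s using Finset.induction_on with
  | empty => simp
  | insert a s ha ih => rw [Finset.sum_insert ha, Finset.sum_insert ha, two_mul_lift_add, ih]

@[simp] theorem weight_zero : weight (0 : Fin k → ZMod 2) = 0 := by simp [weight]

theorem weight_add (v w : Fin k → ZMod 2) :
    weight (v + w) = weight v + weight w + 2 * lift (v ⬝ᵥ w) := by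
  simp [weight, dotProduct, two_mul_lift_sum, lift_add, Finset.sum_add_distrib]

theorem two_mul_weight_of_dotProduct_self (v : Fin k → ZMod 2) (h : v ⬝ᵥ v = 0) :
    2 * weight v = 0 := by
  have := weight_add v v
  rw [add_self_vec, h] at this
  simpa [two_mul] using this.symm

/-- The upper bit of a number modulo four. -/
def upperBit (z : ZMod 4) : ZMod 2 := if 2 ≤ z.val then 1 else 0

theorem upperBit_add (z : ZMod 4) (y : ZMod 2) (hz : 2 * z = 0) :
    upperBit (z + 2 * lift y) = upperBit z + y := by
  revert z y; decide

theorem two_mul_lift_upperBit (z : ZMod 4) (hz : 2 * z = 0) : 2 * lift (upperBit z) = z := by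
  revert z; decide

/-- The shift of the support of the output distribution. -/
def shift (P : Matrix (Fin k) (Fin n) (ZMod 2)) (j : Fin n) : ZMod 2 :=
  upperBit (weight fun a => (reduction P (n + 1)).1 a j)

theorem two_mul_weight_reduction (P : Matrix (Fin k) (Fin n) (ZMod 2)) (j : Fin n) :
    2 * weight (fun a => (reduction P (n + 1)).1 a j) = 0 :=
  two_mul_weight_of_dotProduct_self _
    (congrFun (congrFun (reduction_transpose_mul_reduction P) j) j)

/-- The weight of a column of W is 0 or 2 modulo 4, so adding twice a bit toggles the upper bit of
the counter accordingly. -/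
theorem upperBit_finalCount (P : Matrix (Fin k) (Fin n) (ZMod 2)) (coin : Fin n → ZMod 2) :
    (fun j => upperBit (finalCount P (reduction P (n + 1)).1 coin j))
      = shift P + (Pᵀ * P) *ᵥ coin := by
  funext j
  have e : finalCount P (reduction P (n + 1)).1 coin j
      = weight (fun a => (reduction P (n + 1)).1 a j) + 2 * lift (((Pᵀ * P) *ᵥ coin) j) := by
    have h : ((Pᵀ * P) *ᵥ coin) j = ∑ a, (P *ᵥ coin) a * P a j := by
      rw [← Matrix.mulVec_mulVec]
      simp only [Matrix.mulVec, dotProduct, Matrix.transpose_apply]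
      exact Finset.sum_congr rfl fun a _ => mul_comm _ _
    rw [h, two_mul_lift_sum, weight, ← Finset.sum_add_distrib]
    rfl
  rw [e, upperBit_add _ _ (two_mul_weight_reduction P j)]
  rfl

/-- On the kernel Pe = We, a sum of columns of W. These are mutually orthogonal, so the cross terms
in `weight_add` vanish and the weights add up. -/
theorem weight_mulVec (P : Matrix (Fin k) (Fin n) (ZMod 2)) (e : BitVec2 n)
    (he : (Pᵀ * P) *ᵥ e = 0) : weight (P *ᵥ e) = 2 * lift (e ⬝ᵥ shift P) := by
  have h : ∀ s : Finset (Fin n), weight (∑ j ∈ s, e j • fun a => (reduction P (n + 1)).1 a j)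
      = 2 * lift (∑ j ∈ s, e j * shift P j) := by
    intro s
    induction s using Finset.induction_on with
    | empty => simp
    | insert j s hj ih =>
      have h₁ : (e j • fun a => (reduction P (n + 1)).1 a j)
          ⬝ᵥ (∑ j ∈ s, e j • fun a => (reduction P (n + 1)).1 a j) = 0 := by
        rw [dotProduct_sum]
        refine Finset.sum_eq_zero fun l _ => ?_
        have h₂ : (fun a => (reduction P (n + 1)).1 a j) ⬝ᵥ (fun a => (reduction P (n + 1)).1 a l)
          = 0 := congrFun (congrFun (reduction_transpose_mul_reduction P) j) l
        rw [smul_dotProduct, dotProduct_smul, h₂]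
        simp
      rw [Finset.sum_insert hj, Finset.sum_insert hj, weight_add, h₁, two_mul_lift_add, ih]
      rcases zmod_two_cases (e j) with h₀ | h₀
      · simp [h₀]
      · simp [h₀, shift, two_mul_lift_upperBit _ (two_mul_weight_reduction P j)]
  rw [← reduction_mulVec P e he, dotProduct, ← h]
  congr 1
  funext a
  simp [Matrix.mulVec, dotProduct, mul_comm]

end Weight

/-! ### Output distribution and sampler at odd multiples of π/4. -/

section Distribution

variable {k n : ℕ}

/-- The additive character of the integers modulo four with a given value at one. -/
def quarterChar (z : ℂ) (hz : z ^ 2 = -1) : AddChar (ZMod 4) ℂ :=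
  AddChar.zmodChar 4 (show z ^ 4 = 1 by rw [show z ^ 4 = (z ^ 2) ^ 2 by ring, hz]; norm_num)

theorem quarterChar_two_mul_lift (z : ℂ) (hz : z ^ 2 = -1) (y : ZMod 2) :
    quarterChar z hz (2 * lift y) = sign y := by
  rcases zmod_two_cases y with rfl | rfl
  · simp
  · rw [sign_one, ← hz]; rfl

theorem quarterChar_lift (z : ℂ) (hz : z ^ 2 = -1) (y : ZMod 2) :
    quarterChar z hz (lift y) = phase z y := by
  rcases zmod_two_cases y with rfl | rfl
  · simp [phase]
  · simp only [phase, one_ne_zero, if_false]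
    exact pow_one z

theorem prod_phase (z : ℂ) (hz : z ^ 2 = -1) (v : Fin k → ZMod 2) :
    ∏ a, phase z (v a) = quarterChar z hz (weight v) := by
  have h := map_prod (quarterChar z hz).toMonoidHom (fun a => Multiplicative.ofAdd (lift (v a)))
    Finset.univ
  rw [← ofAdd_sum] at h
  exact (h.trans (Finset.prod_congr rfl fun a _ => quarterChar_lift z hz _)).symm

theorem conj_sign (y : ZMod 2) : starRingEnd ℂ (sign y) = sign y := by
  rcases zmod_two_cases y with rfl | rfl <;> simp

theorem normSq_sum_sign (P : Matrix (Fin k) (Fin n) (ZMod 2)) (z : ℂ) (hz : z ^ 2 = -1)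
    (x : BitVec2 n) :
    ((‖∑ c, sign (x ⬝ᵥ c) * ∏ i, phase z ((P *ᵥ c) i)‖ ^ 2 : ℝ) : ℂ)
      = 2 ^ n * ∑ e : BitVec2 n,
        if (Pᵀ * P) *ᵥ e = 0 then sign (x ⬝ᵥ e) * sign (e ⬝ᵥ shift P) else 0 := by
  have h : ∀ c e : BitVec2 n, sign (x ⬝ᵥ c) * quarterChar z hz (weight (P *ᵥ c))
      * starRingEnd ℂ (sign (x ⬝ᵥ (c + e)) * quarterChar z hz (weight (P *ᵥ (c + e))))
      = sign (x ⬝ᵥ e) * quarterChar z hz (-weight (P *ᵥ e)) * sign (((Pᵀ * P) *ᵥ e) ⬝ᵥ c) := by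
    intro c e
    have h₁ : sign (x ⬝ᵥ c) * sign (x ⬝ᵥ c) = 1 := by
      rw [← sign_add, CharTwo.add_self_eq_zero, sign_zero]
    have h₂ : ((Pᵀ * P) *ᵥ e) ⬝ᵥ c = (P *ᵥ c) ⬝ᵥ (P *ᵥ e) := by
      rw [← Matrix.mulVec_mulVec, dotProduct_comm, Matrix.dotProduct_mulVec, Matrix.vecMul_transpose]
    have h₃ : weight (P *ᵥ c) + -weight (P *ᵥ (c + e))
        = -weight (P *ᵥ e) + 2 * lift (((Pᵀ * P) *ᵥ e) ⬝ᵥ c) := by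
      rw [Matrix.mulVec_add, weight_add, h₂]
      have : ∀ y, -(2 * lift y) = 2 * lift y := by decide
      linear_combination this ((P *ᵥ c) ⬝ᵥ (P *ᵥ e))
    rw [map_mul, conj_sign, ← AddChar.map_neg_eq_conj, dotProduct_add, sign_add,
      show ∀ a b c d : ℂ, a * b * (a * c * d) = a * a * (c * (b * d)) by intros; ring, h₁, one_mul,
      ← AddChar.map_add_eq_mul, h₃, AddChar.map_add_eq_mul, quarterChar_two_mul_lift, mul_assoc]
  push_cast
  simp_rw [prod_phase z hz]
  rw [← Complex.mul_conj', map_sum, Finset.sum_mul_sum]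
  calc _ = ∑ c : BitVec2 n, ∑ e : BitVec2 n,
        sign (x ⬝ᵥ e) * quarterChar z hz (-weight (P *ᵥ e)) * sign (((Pᵀ * P) *ᵥ e) ⬝ᵥ c) := by
        refine Finset.sum_congr rfl fun c _ => ?_
        -- With the second index written as c + e, the summand depends on c only through a
        -- character, and the sum over c selects the kernel of PᵀP.
        rw [← Equiv.sum_comp (Equiv.addLeft c)]
        exact Finset.sum_congr rfl fun e _ => h c e
    _ = _ := by
        rw [Finset.sum_comm, Finset.mul_sum]
        refine Finset.sum_congr rfl fun e _ => ?_
        rw [← Finset.mul_sum, sum_sign_vec]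
        split_ifs with he
        · have : ∀ y, -(2 * lift y) = 2 * lift y := by decide
          rw [weight_mulVec P e he, this, quarterChar_two_mul_lift]
          ring
        · ring

theorem sq_exp_quarter (m : ℤ) :
    Complex.exp (-(2 * (((2 * (m : ℝ) + 1) * (Real.pi / 4) : ℝ) : ℂ) * Complex.I)) ^ 2 = -1 := by
  rw [← Complex.exp_nat_mul, ← exp_odd_mul_pi m]
  push_cast
  ring_nf

theorem outputProb_of_pi_div_four (θ : ℝ) (P : Matrix (Fin k) (Fin n) (ZMod 2)) (m : ℤ)
    (hθ : θ = (2 * (m : ℝ) + 1) * (Real.pi / 4)) (x : BitVec2 n) :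
    ((XProgram.constantAction θ P).outputProb x : ℂ) = (2 ^ n : ℂ)⁻¹ * ∑ e : BitVec2 n,
      if (Pᵀ * P) *ᵥ e = 0 then sign (x ⬝ᵥ e) * sign (e ⬝ᵥ shift P) else 0 := by
  have h2 : (2 : ℂ) ^ n ≠ 0 := pow_ne_zero n two_ne_zero
  subst hθ
  rw [outputProb_constantAction, Complex.ofReal_mul, normSq_sum_sign P _ (sq_exp_quarter m)]
  push_cast
  field_simp

/-- Detecting the event by a sum over characters e and then averaging over the coins leaves the e
with PᵀPe = 0, by symmetry of PᵀP. This is the same Fourier sum as in `outputProb_of_pi_div_four`.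
-/
theorem card_fiber {L : ℕ} (hn : n ≤ L) (P : Matrix (Fin k) (Fin n) (ZMod 2)) (x : BitVec2 n) :
    (2 ^ n : ℂ) * (Nat.card {r : Fin L → Bool // shift P + (Pᵀ * P) *ᵥ coinVec hn r = x} : ℂ)
      = 2 ^ L * ∑ e : BitVec2 n,
        if (Pᵀ * P) *ᵥ e = 0 then sign (x ⬝ᵥ e) * sign (e ⬝ᵥ shift P) else 0 := by
  have h : ∀ r : Fin L → Bool, ∑ e : BitVec2 n,
      sign ((x + (shift P + (Pᵀ * P) *ᵥ coinVec hn r)) ⬝ᵥ e)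
      = if shift P + (Pᵀ * P) *ᵥ coinVec hn r = x then (2 : ℂ) ^ n else 0 := by
    intro r
    rw [sum_sign_vec]
    refine if_congr ?_ rfl rfl
    rw [eq_comm, eq_add_vec_iff, zero_add, eq_comm]
  have h' : ∀ (e : BitVec2 n) (r : Fin L → Bool),
      sign ((x + (shift P + (Pᵀ * P) *ᵥ coinVec hn r)) ⬝ᵥ e)
      = sign (x ⬝ᵥ e) * sign (e ⬝ᵥ shift P) * sign (((Pᵀ * P) *ᵥ e) ⬝ᵥ coinVec hn r) := by
    intro e r
    rw [add_dotProduct, add_dotProduct, sign_add, sign_add, dotProduct_comm (shift P),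
      dotProduct_comm (_ *ᵥ _) e, Matrix.dotProduct_mulVec, ← Matrix.mulVec_transpose,
      Matrix.transpose_mul, Matrix.transpose_transpose, mul_assoc]
  classical
  rw [Nat.card_eq_fintype_card, Fintype.card_subtype, Finset.card_filter]
  push_cast
  rw [Finset.mul_sum, Finset.mul_sum]
  simp_rw [mul_ite, mul_one, mul_zero, ← h]
  rw [Finset.sum_comm]
  refine Finset.sum_congr rfl fun e _ => ?_
  simp_rw [h', ← Finset.mul_sum, sum_sign_coinVec]
  split_ifs <;> ring

/-- The sampler. -/
def sample (Q : QuarterProgram)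
    (r : Fin ((Polynomial.X : Polynomial ℕ).eval Q.encode.length) → Bool) : BitVec2 Q.n :=
  fun j => upperBit (finalCount Q.P (reduction Q.P (Q.n + 1)).1
    (coinVec ((width_le_length_encode Q).trans (Polynomial.eval_X (x := Q.encode.length)).ge) r) j)

theorem bitList_upperBit (f : Fin n → ZMod 4) :
    bitList (fun j => upperBit (f j)) = List.ofFn fun j => decide (2 ≤ (f j).val) := by
  refine congrArg List.ofFn (funext fun j => ?_)
  have h : ∀ z : ZMod 4, decide (upperBit z = 1) = decide (2 ≤ z.val) := by decide
  exact h (f j)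

theorem outputProb_eq_card_div (Q : QuarterProgram) (x : BitVec2 Q.n) :
    Q.toXProgram.outputProb x
      = (Nat.card {r // sample Q r = x} : ℝ)
        / 2 ^ ((Polynomial.X : Polynomial ℕ).eval Q.encode.length) := by
  have h := outputProb_of_pi_div_four Q.action Q.P Q.m rfl x
  have h' := card_fiber ((width_le_length_encode Q).trans
    (Polynomial.eval_X (x := Q.encode.length)).ge) Q.P x
  simp_rw [← upperBit_finalCount] at h'
  have h2 : (2 : ℂ) ^ Q.n ≠ 0 := pow_ne_zero _ two_ne_zero
  have h3 : (2 : ℂ) ^ ((Polynomial.X : Polynomial ℕ).eval Q.encode.length) ≠ 0 :=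
    pow_ne_zero _ two_ne_zero
  apply Complex.ofReal_injective
  rw [QuarterProgram.toXProgram, h]
  push_cast
  rw [eq_div_iff h3, mul_assoc, mul_comm (∑ e : BitVec2 Q.n, _), ← h', ← mul_assoc,
    inv_mul_cancel₀ h2, one_mul]
  rfl

theorem exactlySamplable_quarterProgram :
    ExactlySamplableInPolyTime QuarterProgram.encode QuarterProgram.n
      (fun Q x => Q.toXProgram.outputProb x) :=
  ⟨Polynomial.X, sample, ⟨computableInPolyTime _ _ sample fun _ _ => bitList_upperBit _⟩,
    outputProb_eq_card_div⟩

/-- For one qubit and P = 1 the kernel of PᵀP is trivial, so the output is a fair bit and the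
entropy is 1. -/
theorem collisionEntropy_one_ne_zero (θ : ℝ) (m : ℤ)
    (hθ : θ = (2 * (m : ℝ) + 1) * (Real.pi / 4)) :
    collisionEntropy (XProgram.constantAction θ
      (1 : Matrix (Fin 1) (Fin 1) (ZMod 2))).outputProb ≠ 0 := by
  have h : ∀ x, (XProgram.constantAction θ (1 : Matrix (Fin 1) (Fin 1) (ZMod 2))).outputProb x
      = 1 / 2 := by
    intro x
    apply Complex.ofReal_injective
    rw [outputProb_of_pi_div_four θ 1 m hθ x]
    simp
  rw [collisionEntropy]
  simp only [h, Finset.sum_const, Finset.card_univ, Fintype.card_fun, ZMod.card, Fintype.card_fin,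
    nsmul_eq_mul]
  rw [show ((2 ^ 1 : ℕ) : ℝ) * (1 / 2) ^ 2 = 2⁻¹ by norm_num, Real.logb_inv,
    Real.logb_self_eq_one one_lt_two]
  norm_num

end Distribution

end QuarterSampler

end

theorem lemma2 :
    (∀ (k n : ℕ) (P : Matrix (Fin k) (Fin n) (ZMod 2)) (θ : ℝ),
      ((∃ m : ℤ, θ = m * Real.pi) →
        (∀ x : BitVec2 n,
          (XProgram.constantAction θ P).outputProb x = if x = 0 then 1 else 0) ∧
        collisionEntropy (XProgram.constantAction θ P).outputProb = 0) ∧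
      ((∃ m : ℤ, θ = (2 * (m : ℝ) + 1) * (Real.pi / 2)) →
        (∀ x : BitVec2 n,
          (XProgram.constantAction θ P).outputProb x = if x = ∑ i, P i then 1 else 0) ∧
        collisionEntropy (XProgram.constantAction θ P).outputProb = 0)) ∧
    (∀ θ : ℝ, (∃ m : ℤ, θ = (2 * (m : ℝ) + 1) * (Real.pi / 4)) →
      ∃ (k n : ℕ) (P : Matrix (Fin k) (Fin n) (ZMod 2)),
        collisionEntropy (XProgram.constantAction θ P).outputProb ≠ 0) ∧
    ExactlySamplableInPolyTime QuarterProgram.encode QuarterProgram.n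
      (fun Q x => Q.toXProgram.outputProb x) := by
  refine ⟨fun k n P θ => ⟨?_, ?_⟩, ?_, QuarterSampler.exactlySamplable_quarterProgram⟩
  · rintro ⟨m, hm⟩
    have h := QuarterSampler.outputProb_of_pi θ P m hm
    exact ⟨h, QuarterSampler.collisionEntropy_indicator _ _ h⟩
  · rintro ⟨m, hm⟩
    have h := QuarterSampler.outputProb_of_pi_div_two θ P m hm
    exact ⟨h, QuarterSampler.collisionEntropy_indicator _ _ h⟩
  · rintro θ ⟨m, hm⟩
    exact ⟨1, 1, 1, QuarterSampler.collisionEntropy_one_ne_zero θ m hm⟩
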